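/- Let $B$ be a quaternion algebra over $\mathbb Q$ with main involution $x\mapsto\bar x$, and let $p$ be a prime at which $B$ is ramified, i.e. $B_p=B\otimes_{\mathbb Q}\mathbb Q_p$ is a division algebra. For $m\in M_2(B_p)$ put $m^*=\overline m^{\,t}$, and let $$GU_2(B_p)=\{g\in M_2(B_p): g^*g=\nu(g)I,\ \nu(g)\in\mathbb Q_p^\times\},\qquad U_p=\{A\in M_2(B_p): A^*=A\},$$ where $GU_2(B_p)$ acts on $U_p$ by conjugation $A\mapsto gAg^{-1}$, the subgroup $\mathbb Q_p^\times$ of scalar matrices acting trivially. Let $R_p$ be the maximal order of $B_p$, let $\mathfrak p\subset R_p$ be its maximal ideal, consisting of the elements of $R_p$ whose reduced norm is divisible by $p$, and let $\xi\in M_2(B_p)$ be such that $\xi^*\xi=\begin{pmatrix}0&1\\1&0\end{pmatrix}$. Put $$L_p=\xi\begin{pmatrix}\mathfrak p\\ R_p\end{pmatrix}\subset B_p^2,\qquad K_p^-=\{g\in GU_2(B_p): gL_p=L_p\},\qquad \omega_p=\xi\begin{pmatrix}0&p\\1&0\end{pmatrix}\xi^{-1}\in GU_2(B_p),$$ $$\mathfrak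 U_p^-=\xi\left\{\begin{pmatrix}r&ps\\ t&\bar r\end{pmatrix}: r\in R_p,\ s,t\in\mathbb Z_p\right\}\xi^{-1}.$$ Then: 1. $\mathfrak U_p^-$ is a $\mathbb Z_p$-lattice in $U_p$ (a finitely generated $\mathbb Z_p$-submodule spanning $U_p$ over $\mathbb Q_p$), and it is preserved under conjugation by every element of $K_p^-$ and by the Atkin–Lehner element $\omega_p$: $g\,\mathfrak U_p^-g^{-1}=\mathfrak U_p^-$ for all $g\in K_p^-$ and for $g=\omega_p$. 2. The subgroup of $GU_2(B_p)/\mathbb Q_p^\times$ generated by the images of $K_p^-$ and $\omega_p$ is the full stabiliser of $\mathfrak U_p^-$ in $GU_2(B_p)/\mathbb Q_p^\times$. -/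

import Mathlib

open scoped Quaternion Matrix TensorProduct

noncomputable section

namespace QuatUnitary

/-- The completion `B_p = B ⊗ ℚ_p` of the quaternion algebra `B = ℍ[ℚ, a, b]` over `ℚ`
(generators `i, j` with `i² = a`, `j² = b`, `ij = -ji`). In characteristic zero every quaternion
algebra has this form. The main involution of `B_p` is Mathlib's `star` on `ℍ[ℚ_[p], a, b]`.
See `exists_baseChange` for the identification with the tensor product. -/
abbrev Bp (p : ℕ) [Fact p.Prime] (a b : ℚ) : Type :=
  ℍ[ℚ_[p], (a : ℚ_[p]), (b : ℚ_[p])]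

/-- `B_p` is the base change of `B` to `ℚ_p`, compatibly with the main involutions. -/
theorem exists_baseChange (p : ℕ) [Fact p.Prime] (a b : ℚ) :
    ∃ e : ℚ_[p] ⊗[ℚ] ℍ[ℚ, a, b] ≃ₐ[ℚ_[p]] Bp p a b,
      ∀ (c : ℚ_[p]) (x : ℍ[ℚ, a, b]), e (c ⊗ₜ[ℚ] star x) = star (e (c ⊗ₜ[ℚ] x)) := by
  let f : ℍ[ℚ, a, b] →ₐ[ℚ] ℍ[ℚ_[p], (a : ℚ_[p]), (b : ℚ_[p])] :=
    AlgHom.ofLinearMap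
      { toFun := fun x => ⟨x.re, x.imI, x.imJ, x.imK⟩
        map_add' := fun x y => by ext <;> simp
        map_smul' := fun c x => by
          ext <;> simp [Rat.smul_def] }
      (by ext <;> simp) (fun x y => by ext <;> simp)
  have hf (x) : f x = ⟨x.re, x.imI, x.imJ, x.imK⟩ := rfl
  let g : ℚ_[p] ⊗[ℚ] ℍ[ℚ, a, b] →ₐ[ℚ_[p]] ℍ[ℚ_[p], (a : ℚ_[p]), (b : ℚ_[p])] :=
    Algebra.TensorProduct.lift (Algebra.ofId _ _) f (fun c x => Algebra.commutes _ _)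
  have hg (c : ℚ_[p]) (x) : g (c ⊗ₜ x) = c • f x := by
    refine (Algebra.TensorProduct.lift_tmul _ _ _ c x).trans ?_
    rw [Algebra.ofId_apply, Algebra.smul_def]
  have hsurj : Function.Surjective g := by
    intro y
    refine ⟨y.re ⊗ₜ 1 + y.imI ⊗ₜ ⟨0, 1, 0, 0⟩ + y.imJ ⊗ₜ ⟨0, 0, 1, 0⟩ +
      y.imK ⊗ₜ ⟨0, 0, 0, 1⟩, ?_⟩
    simp only [map_add, hg, hf]
    ext <;> simp
  have hinj : Function.Injective g := by
    change Function.Injective g.toLinearMap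
    refine (LinearMap.injective_iff_surjective_of_finrank_eq_finrank ?_).2 hsurj
    rw [Module.finrank_baseChange, QuaternionAlgebra.finrank_eq_four,
      QuaternionAlgebra.finrank_eq_four]
  refine ⟨AlgEquiv.ofBijective g ⟨hinj, hsurj⟩, fun c x => ?_⟩
  have he (z) : AlgEquiv.ofBijective g ⟨hinj, hsurj⟩ z = g z := rfl
  rw [he, he, hg, hg, QuaternionAlgebra.star_smul, hf, hf]
  congr 1

/-- `B` is ramified at `p`: the completion `B_p` is a division algebra. -/
def IsRamifiedAt (p : ℕ) [Fact p.Prime] (a b : ℚ) : Prop :=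
  ∀ x : Bp p a b, x ≠ 0 → IsUnit x

/-- The reduced norm `x * star x` of `B_p`, as an element of `ℚ_p`. -/
def nrd {p : ℕ} [Fact p.Prime] {a b : ℚ} (x : Bp p a b) : ℚ_[p] := (x * star x).re

theorem algebraMap_nrd {p : ℕ} [Fact p.Prime] {a b : ℚ} (x : Bp p a b) :
    algebraMap ℚ_[p] (Bp p a b) (nrd x) = x * star x :=
  (QuaternionAlgebra.mul_star_eq_coe x).symm

/-- A maximal order of `B_p`: a `ℤ_p`-subalgebra that is a full lattice in `B_p` (an order), and
that is not properly contained in another order. -/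
def IsMaximalOrder {p : ℕ} [Fact p.Prime] {a b : ℚ} (R : Subalgebra ℤ_[p] (Bp p a b)) : Prop :=
  Maximal (fun R' : Subalgebra ℤ_[p] (Bp p a b) =>
    Submodule.IsLattice ℚ_[p] (Subalgebra.toSubmodule R')) R

/-- The matrix algebra `M_2(B_p)`; its involution `m ↦ m^*` (transpose of the entrywise main
involution) is `Matrix.conjTranspose`, written `mᴴ`. -/
abbrev M2 (p : ℕ) [Fact p.Prime] (a b : ℚ) : Type := Matrix (Fin 2) (Fin 2) (Bp p a b)

/-- `GU_2(B_p) = {g ∈ M_2(B_p) : g^* g = ν(g) I, ν(g) ∈ ℚ_p^×}`. -/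
def GU2 (p : ℕ) [Fact p.Prime] (a b : ℚ) : Subgroup (M2 p a b)ˣ where
  carrier := {g | ∃ ν : ℚ_[p], ν ≠ 0 ∧ (g : M2 p a b)ᴴ * (g : M2 p a b) = ν • 1}
  one_mem' := ⟨1, one_ne_zero, by simp⟩
  mul_mem' := by
    rintro g h ⟨ν, hν, hg⟩ ⟨μ, hμ, hh⟩
    refine ⟨ν * μ, mul_ne_zero hν hμ, ?_⟩
    rw [Units.val_mul, Matrix.conjTranspose_mul, Matrix.mul_assoc,
      ← Matrix.mul_assoc _ (g : M2 p a b), hg, Matrix.smul_mul, Matrix.one_mul,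
      Matrix.mul_smul, hh, smul_smul]
  inv_mem' := by
    rintro g ⟨ν, hν, hg⟩
    refine ⟨ν⁻¹, inv_ne_zero hν, ?_⟩
    have h1 : (g : M2 p a b)ᴴ = ν • ((g⁻¹ : (M2 p a b)ˣ) : M2 p a b) := by
      calc (g : M2 p a b)ᴴ = (g : M2 p a b)ᴴ * ((g : M2 p a b) * (g⁻¹ : (M2 p a b)ˣ)) := by simp
        _ = _ := by rw [← Matrix.mul_assoc, hg, Matrix.smul_mul, Matrix.one_mul]
    have h2 : ((g⁻¹ : (M2 p a b)ˣ) : M2 p a b) = ν⁻¹ • (g : M2 p a b)ᴴ := by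
      rw [h1, smul_smul, inv_mul_cancel₀ hν, one_smul]
    have h3 : ((g⁻¹ : (M2 p a b)ˣ) : M2 p a b)ᴴ * (g : M2 p a b)ᴴ = 1 := by
      rw [← Matrix.conjTranspose_mul]; simp
    nth_rewrite 2 [h2]
    rw [Matrix.mul_smul, h3]

/-- The central subgroup `ℚ_p^×` of scalar matrices in `GU_2(B_p)`. -/
def scalars (p : ℕ) [Fact p.Prime] (a b : ℚ) : Subgroup (GU2 p a b) where
  carrier := {g | ∃ c : ℚ_[p], c ≠ 0 ∧ ((g : (M2 p a b)ˣ) : M2 p a b) = c • 1}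
  one_mem' := ⟨1, one_ne_zero, by simp⟩
  mul_mem' := by
    rintro g h ⟨c, hc, hg⟩ ⟨d, hd, hh⟩
    exact ⟨c * d, mul_ne_zero hc hd, by simp [hg, hh, smul_smul, mul_comm]⟩
  inv_mem' := by
    rintro g ⟨c, hc, hg⟩
    refine ⟨c⁻¹, inv_ne_zero hc, ?_⟩
    have h : ((g : (M2 p a b)ˣ) : M2 p a b) * (((g : (M2 p a b)ˣ)⁻¹ : (M2 p a b)ˣ) : M2 p a b) = 1 :=
      Units.mul_inv _
    rw [hg, Matrix.smul_mul, Matrix.one_mul] at h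
    rw [Subgroup.coe_inv, ← h, smul_smul, inv_mul_cancel₀ hc, one_smul]

instance (p : ℕ) [Fact p.Prime] (a b : ℚ) : (scalars p a b).Normal where
  conj_mem := by
    rintro n ⟨c, hc, hn⟩ g
    exact ⟨c, hc, by simp [hn]⟩

/-- The hermitian form `H = (0 1; 1 0)`. -/
def H (p : ℕ) [Fact p.Prime] (a b : ℚ) : M2 p a b := !![0, 1; 1, 0]

/-- The `ℤ_p`-lattice `L_p = ξ (𝔭; R) ⊆ B_p^2` of column vectors, where `R` is the maximal order
and `𝔭` its maximal ideal, the set of elements of `R` whose norm is divisible by `p`. -/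
def L {p : ℕ} [Fact p.Prime] {a b : ℚ} (R : Subalgebra ℤ_[p] (Bp p a b)) (ξ : (M2 p a b)ˣ) :
    Set (Fin 2 → Bp p a b) :=
  {v | ∃ x ∈ R, ∃ y ∈ R, (∃ c : ℤ_[p], nrd x = (p : ℚ_[p]) * (c : ℚ_[p])) ∧
    v = (ξ : M2 p a b) *ᵥ ![x, y]}

/-- `K_p^-`: the stabiliser `{g : g L_p = L_p}` of `L_p` under left multiplication. -/
def Kminus {p : ℕ} [Fact p.Prime] {a b : ℚ} (R : Subalgebra ℤ_[p] (Bp p a b)) (ξ : (M2 p a b)ˣ) :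
    Subgroup (GU2 p a b) where
  carrier := {g | ∀ v, ((g : (M2 p a b)ˣ) : M2 p a b) *ᵥ v ∈ L R ξ ↔ v ∈ L R ξ}
  one_mem' := fun v => by simp
  mul_mem' := by
    intro g h hg hh v
    rw [Subgroup.coe_mul, Units.val_mul, ← Matrix.mulVec_mulVec]
    exact (hg _).trans (hh v)
  inv_mem' := by
    intro g hg v
    rw [← hg, Matrix.mulVec_mulVec, Subgroup.coe_inv, Units.mul_inv, Matrix.one_mulVec]

/-- The matrix `ω'_p = (0 p; 1 0)`. -/
def atkinLehner' (p : ℕ) [Fact p.Prime] (a b : ℚ) : (M2 p a b)ˣ where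
  val := !![0, (p : Bp p a b); 1, 0]
  inv := !![0, 1; algebraMap ℚ_[p] (Bp p a b) (p : ℚ_[p])⁻¹, 0]
  val_inv := by
    have hp : (p : ℚ_[p]) ≠ 0 := by exact_mod_cast (Fact.out : p.Prime).ne_zero
    have h : (p : Bp p a b) * algebraMap ℚ_[p] (Bp p a b) (p : ℚ_[p])⁻¹ = 1 := by
      rw [← map_natCast (algebraMap ℚ_[p] (Bp p a b)), ← map_mul, mul_inv_cancel₀ hp, map_one]
    simp only [Matrix.mul_fin_two, h, Matrix.one_fin_two]; simp
  inv_val := by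
    have hp : (p : ℚ_[p]) ≠ 0 := by exact_mod_cast (Fact.out : p.Prime).ne_zero
    have h : algebraMap ℚ_[p] (Bp p a b) (p : ℚ_[p])⁻¹ * (p : Bp p a b) = 1 := by
      rw [← map_natCast (algebraMap ℚ_[p] (Bp p a b)), ← map_mul, inv_mul_cancel₀ hp, map_one]
    simp only [Matrix.mul_fin_two, h, Matrix.one_fin_two]; simp

/-- The Atkin–Lehner element `ω_p = ξ ω'_p ξ⁻¹` of `GU_2(B_p)`, where `ξ^* ξ = H`. -/
def atkinLehner {p : ℕ} [Fact p.Prime] {a b : ℚ} (ξ : (M2 p a b)ˣ)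
    (hξ : (ξ : M2 p a b)ᴴ * (ξ : M2 p a b) = H p a b) : GU2 p a b :=
  ⟨ξ * atkinLehner' p a b * ξ⁻¹, by
    refine ⟨p, by exact_mod_cast (Fact.out : p.Prime).ne_zero, ?_⟩
    have h1 : ((atkinLehner' p a b : (M2 p a b)ˣ) : M2 p a b)ᴴ * (H p a b) * (atkinLehner' p a b : M2 p a b)
        = (p : ℚ_[p]) • H p a b := by
      have e : ((atkinLehner' p a b : (M2 p a b)ˣ) : M2 p a b) = !![0, (p : Bp p a b); 1, 0] := rfl
      have hs : (p : ℚ_[p]) • (1 : Bp p a b) = p := by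
        rw [← Algebra.algebraMap_eq_smul_one, map_natCast]
      rw [e, H]
      ext1 i j
      fin_cases i <;> fin_cases j <;>
        simp [Matrix.mul_apply, Fin.sum_univ_two, Matrix.conjTranspose_apply, hs]
    have h2 : ((ξ⁻¹ : (M2 p a b)ˣ) : M2 p a b)ᴴ * H p a b * ((ξ⁻¹ : (M2 p a b)ˣ) : M2 p a b) = 1 := by
      rw [← hξ, ← Matrix.mul_assoc, ← Matrix.conjTranspose_mul, Matrix.mul_assoc]; simp
    calc _ = ((ξ⁻¹ : (M2 p a b)ˣ) : M2 p a b)ᴴ *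
          ((atkinLehner' p a b : M2 p a b)ᴴ * ((ξ : M2 p a b)ᴴ * (ξ : M2 p a b)) * (atkinLehner' p a b : M2 p a b))
            * ((ξ⁻¹ : (M2 p a b)ˣ) : M2 p a b) := by
          simp only [Units.val_mul, Matrix.conjTranspose_mul, Matrix.mul_assoc]
      _ = _ := by
          rw [hξ, h1, Matrix.mul_smul, Matrix.smul_mul, h2]⟩

/-- The space `U_p = {A ∈ M_2(B_p) : A^* = A}` on which `GU_2(B_p)` acts by conjugation. -/
def Up (p : ℕ) [Fact p.Prime] (a b : ℚ) : Submodule ℚ_[p] (M2 p a b) where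
  carrier := {A | Aᴴ = A}
  zero_mem' := by simp
  add_mem' := by
    intro A B hA hB
    change (A + B)ᴴ = A + B
    rw [Matrix.conjTranspose_add, show Aᴴ = A from hA, show Bᴴ = B from hB]
  smul_mem' := by
    intro c A hA
    change (c • A)ᴴ = c • A
    ext1 i j
    have h : star (A j i) = A i j := congrFun (congrFun (show Aᴴ = A from hA) i) j
    rw [Matrix.conjTranspose_apply, Matrix.smul_apply, QuaternionAlgebra.star_smul, h,
      Matrix.smul_apply]

/-- The `ℤ_p`-module of matrices `(r ps; t r̄)` with `r` in the maximal order `R`, `s, t ∈ ℤ_p`. -/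
def latticeTilde {p : ℕ} [Fact p.Prime] {a b : ℚ} (R : Subalgebra ℤ_[p] (Bp p a b)) :
    Submodule ℤ_[p] (M2 p a b) where
  carrier := {A | ∃ r ∈ R, ∃ s t : ℤ_[p],
    A = !![r, algebraMap ℤ_[p] (Bp p a b) (p * s); algebraMap ℤ_[p] (Bp p a b) t, star r]}
  zero_mem' := ⟨0, zero_mem R, 0, 0, by ext1 i j; fin_cases i <;> fin_cases j <;> simp⟩
  add_mem' := by
    rintro _ _ ⟨r, hr, s, t, rfl⟩ ⟨r', hr', s', t', rfl⟩
    refine ⟨r + r', add_mem hr hr', s + s', t + t', ?_⟩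
    ext1 i j; fin_cases i <;> fin_cases j <;> simp [mul_add]
  smul_mem' := by
    rintro c _ ⟨r, hr, s, t, rfl⟩
    refine ⟨c • r, R.smul_mem hr c, c * s, c * t, ?_⟩
    ext1 i j
    fin_cases i <;> fin_cases j
    · simp
    · change c • algebraMap ℤ_[p] (Bp p a b) (p * s) = algebraMap ℤ_[p] (Bp p a b) (p * (c * s))
      rw [Algebra.smul_def, ← map_mul, mul_left_comm]
    · change c • algebraMap ℤ_[p] (Bp p a b) t = algebraMap ℤ_[p] (Bp p a b) (c * t)
      rw [Algebra.smul_def, ← map_mul]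
    · simp

/-- The lattice `𝔘_p^- = ξ 𝔘̃_p^- ξ⁻¹`. -/
def latticeU {p : ℕ} [Fact p.Prime] {a b : ℚ} (R : Subalgebra ℤ_[p] (Bp p a b)) (ξ : (M2 p a b)ˣ) :
    Submodule ℤ_[p] (M2 p a b) :=
  (latticeTilde R).map (LinearMap.mulLeftRight ℤ_[p]
    ((ξ : M2 p a b), ((ξ⁻¹ : (M2 p a b)ˣ) : M2 p a b)))

theorem mem_latticeU {p : ℕ} [Fact p.Prime] {a b : ℚ} {R : Subalgebra ℤ_[p] (Bp p a b)}
    {ξ : (M2 p a b)ˣ} {A : M2 p a b} :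
    A ∈ latticeU R ξ ↔
      ∃ C ∈ latticeTilde R, (ξ : M2 p a b) * C * ((ξ⁻¹ : (M2 p a b)ˣ) : M2 p a b) = A :=
  Iff.rfl

/-- The stabiliser `{g ∈ GU_2(B_p) : g Λ g⁻¹ = Λ}` of `Λ` for the conjugation action. -/
def stab {p : ℕ} [Fact p.Prime] {a b : ℚ} (Λ : Submodule ℤ_[p] (M2 p a b)) :
    Subgroup (GU2 p a b) where
  carrier := {g | ∀ A, ((g : (M2 p a b)ˣ) : M2 p a b) * A *
    (((g : (M2 p a b)ˣ)⁻¹ : (M2 p a b)ˣ) : M2 p a b) ∈ Λ ↔ A ∈ Λ}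
  one_mem' := fun A => by simp
  mul_mem' := by
    intro g h hg hh A
    have := (hg _).trans (hh A)
    simpa [Matrix.mul_assoc, mul_inv_rev] using this
  inv_mem' := by
    intro g hg A
    rw [← hg]
    simp [Matrix.mul_assoc]

end QuatUnitary

end

open QuatUnitary

/-! Everything reduces to inequalities for the reduced norm. Since $B_p$ is a division algebra,
Hensel's lemma gives $|\mathrm{trd}\,x|^2\le|\mathrm{nrd}\,x|$ (`norm_two_re_sq_le`). Hence
$|\mathrm{nrd}|$ is ultrametric, and the maximal order is exactly $\{|\mathrm{nrd}\,x|\le 1\}$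
(`IsMaximalOrder.mem_iff`).

Conjugation by $\xi$ turns $*$ into the adjoint $X^\dagger=HX^*H$ and $g$ into a similitude $h$ with
$h^\dagger h=\nu$. Write $\mathcal B(\rho)$ for the matrices with
$|\mathrm{nrd}\,X_{ij}|\le\rho|p|^{j-i}$. These sets multiply, $\mathcal B(\rho)\mathcal
B(\sigma)\subseteq\mathcal B(\rho\sigma)$, and are stable under $\dagger$. Three descriptions carry
the theorem: the lattice is $\{A=A^\dagger\}\cap\mathcal B(1)$ (`mem_latticeTilde_iff`); its
stabiliser is given by $h\in\mathcal B(|\nu|)$ (`mem_stab_iff_mem_gradedBall`); $K_p^-$ is given by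
$h\in\mathcal B(1)$ and $|\nu|=1$ (`mem_Kminus_iff_mem_gradedBall`).

Scaling $h$ by $c$ multiplies $\nu$ by $c^2$, so a stabilising element with $\nu$ of even valuation
lies in $\mathbb Q_p^\times K_p^-$. The Atkin–Lehner element has multiplier $p$ and reduces odd
valuation to even. -/

namespace QuatUnitary

/-! ### The reduced norm of a division algebra is ultrametric -/

section Norm

variable {p : ℕ} [Fact p.Prime] {a b : ℚ}

theorem nrd_eq (x : Bp p a b) :
    nrd x = x.re ^ 2 - a * x.imI ^ 2 - b * x.imJ ^ 2 + a * b * x.imK ^ 2 := by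
  simp only [nrd, QuaternionAlgebra.re_mul, QuaternionAlgebra.re_star, QuaternionAlgebra.imI_star,
    QuaternionAlgebra.imJ_star, QuaternionAlgebra.imK_star]
  ring

@[simp] theorem nrd_zero : nrd (0 : Bp p a b) = 0 := by simp [nrd]

@[simp] theorem nrd_one : nrd (1 : Bp p a b) = 1 := by simp [nrd]

@[simp] theorem nrd_star (x : Bp p a b) : nrd (star x) = nrd x := by
  simp [nrd_eq]

@[simp] theorem nrd_mul (x y : Bp p a b) : nrd (x * y) = nrd x * nrd y := by
  simp only [nrd_eq, QuaternionAlgebra.re_mul, QuaternionAlgebra.imI_mul,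
    QuaternionAlgebra.imJ_mul, QuaternionAlgebra.imK_mul]
  ring

@[simp] theorem nrd_smul (c : ℚ_[p]) (x : Bp p a b) : nrd (c • x) = c ^ 2 * nrd x := by
  simp only [nrd_eq, QuaternionAlgebra.re_smul, QuaternionAlgebra.imI_smul,
    QuaternionAlgebra.imJ_smul, QuaternionAlgebra.imK_smul, smul_eq_mul]
  ring

@[simp] theorem nrd_algebraMap (c : ℚ_[p]) : nrd (algebraMap ℚ_[p] (Bp p a b) c) = c ^ 2 := by
  rw [Algebra.algebraMap_eq_smul_one, nrd_smul, nrd_one, mul_one]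

@[simp] theorem nrd_padicInt (c : ℤ_[p]) :
    nrd (algebraMap ℤ_[p] (Bp p a b) c) = (c : ℚ_[p]) ^ 2 := by
  rw [IsScalarTower.algebraMap_apply ℤ_[p] ℚ_[p] (Bp p a b), nrd_algebraMap]
  rfl

theorem padicInt_smul (c : ℤ_[p]) (x : Bp p a b) : c • x = (c : ℚ_[p]) • x :=
  (algebraMap_smul ℚ_[p] c x).symm

theorem nrd_add (x y : Bp p a b) : nrd (x + y) = nrd x + nrd y + 2 * (x * star y).re := by
  simp only [nrd_eq, QuaternionAlgebra.re_add, QuaternionAlgebra.imI_add,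
    QuaternionAlgebra.imJ_add, QuaternionAlgebra.imK_add,
    QuaternionAlgebra.re_mul, QuaternionAlgebra.re_star, QuaternionAlgebra.imI_star,
    QuaternionAlgebra.imJ_star, QuaternionAlgebra.imK_star]
  ring

theorem nrd_ne_zero (hB : IsRamifiedAt p a b) {x : Bp p a b} (hx : x ≠ 0) : nrd x ≠ 0 := by
  obtain ⟨u, rfl⟩ := hB x hx
  intro h
  have := nrd_mul (u : Bp p a b) (u⁻¹ : (Bp p a b)ˣ)
  simp [h] at this

theorem nrd_eq_zero (hB : IsRamifiedAt p a b) {x : Bp p a b} : nrd x = 0 ↔ x = 0 :=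
  ⟨fun h => by_contra fun hx => nrd_ne_zero hB hx h, fun h => by simp [h]⟩

theorem norm_two_le_one : ‖(2 : ℚ_[p])‖ ≤ 1 := by
  exact_mod_cast Padic.norm_int_le_one (p := p) 2

/-- The substitution $y=tz$ gives $z^2-z+n/t^2$, which reduces to $z^2-z$ modulo $p$. Its root $0$
is simple, so Hensel's lemma applies for every $p$, including $2$. -/
theorem exists_root_of_norm_lt {t n : ℚ_[p]} (h : ‖n‖ < ‖t‖ ^ 2) :
    ∃ y : ℚ_[p], y ^ 2 - t * y + n = 0 := by
  have ht : t ≠ 0 := by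
    rintro rfl
    simp only [norm_zero, ne_eq, OfNat.ofNat_ne_zero, not_false_eq_true, zero_pow] at h
    exact absurd h (norm_nonneg n).not_gt
  have hc : ‖n / t ^ 2‖ < 1 := by
    rw [norm_div, norm_pow]
    exact (div_lt_one (by positivity)).2 h
  set c : ℤ_[p] := ⟨n / t ^ 2, hc.le⟩ with hcdef
  have hc' : ‖c‖ < 1 := hc
  let F : Polynomial ℤ_[p] := Polynomial.X ^ 2 - Polynomial.X + Polynomial.C c
  obtain ⟨z, hz, -⟩ := hensels_lemma (p := p) (F := F) (a := (0 : ℤ_[p])) (by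
    simpa [F] using hc')
  have hz' : z ^ 2 - z + c = 0 := by simpa [F] using hz
  have hz'' : (z : ℚ_[p]) ^ 2 - z + n / t ^ 2 = 0 := by
    have := congrArg (fun w : ℤ_[p] => (w : ℚ_[p])) hz'
    push_cast at this
    exact this
  refine ⟨t * z, ?_⟩
  have : (t * z) ^ 2 - t * (t * z) + n = t ^ 2 * ((z : ℚ_[p]) ^ 2 - z + n / t ^ 2) := by
    field_simp
  rw [this, hz'', mul_zero]

/-- Here $2\,\mathrm{re}\,x$ is the reduced trace. If the bound failed, the reduced characteristic
polynomial of $x$ would have a root $y\in\mathbb Q_p$. Then $\mathrm{nrd}(x-y)=0$ forces $x=y$, and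
scalars satisfy the bound because $|2|\le1$. -/
theorem norm_two_re_sq_le (hB : IsRamifiedAt p a b) (x : Bp p a b) :
    ‖2 * x.re‖ ^ 2 ≤ ‖nrd x‖ := by
  by_contra! h
  obtain ⟨y, hy⟩ := exists_root_of_norm_lt h
  have hx : x + algebraMap ℚ_[p] (Bp p a b) (-y) = 0 := by
    rw [← nrd_eq_zero hB, nrd_add, nrd_algebraMap]
    have : (x * star (algebraMap ℚ_[p] (Bp p a b) (-y))).re = - (y * x.re) := by
      simp [QuaternionAlgebra.algebraMap_eq, mul_comm]
    rw [this]
    linear_combination hy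
  have hx' : x = algebraMap ℚ_[p] (Bp p a b) y := by
    rw [map_neg] at hx
    exact eq_of_sub_eq_zero (by rw [sub_eq_add_neg, hx])
  rw [hx', nrd_algebraMap, QuaternionAlgebra.algebraMap_eq] at h
  rw [norm_mul, mul_pow, norm_pow] at h
  have h2 : ‖(2 : ℚ_[p])‖ ^ 2 ≤ 1 := pow_le_one₀ (norm_nonneg _) norm_two_le_one
  exact absurd h (not_lt.2 (mul_le_of_le_one_left (by positivity) h2))

/-- The cross term in $\mathrm{nrd}(x+y)$ is the reduced trace of $x\bar y$, which the trace bound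
controls by $|\mathrm{nrd}\,x|\,|\mathrm{nrd}\,y|$. -/
theorem norm_nrd_add_le (hB : IsRamifiedAt p a b) {x y : Bp p a b} {r : ℝ}
    (hx : ‖nrd x‖ ≤ r) (hy : ‖nrd y‖ ≤ r) : ‖nrd (x + y)‖ ≤ r := by
  have h0 : 0 ≤ r := (norm_nonneg _).trans hx
  have h : ‖2 * (x * star y).re‖ ≤ r := by
    refine (sq_le_sq₀ (norm_nonneg _) h0).1 ?_
    refine (norm_two_re_sq_le hB _).trans ?_
    rw [nrd_mul, nrd_star, norm_mul, sq]
    gcongr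
  rw [nrd_add]
  exact (Padic.nonarchimedean _ _).trans
    (max_le ((Padic.nonarchimedean _ _).trans (max_le hx hy)) h)

theorem norm_nrd_mul_le {x y : Bp p a b} {r s : ℝ}
    (hx : ‖nrd x‖ ≤ r) (hy : ‖nrd y‖ ≤ s) : ‖nrd (x * y)‖ ≤ r * s := by
  rw [nrd_mul, norm_mul]
  have := (norm_nonneg _).trans hx
  gcongr

theorem norm_prime_pos : 0 < ‖(p : ℚ_[p])‖ :=
  norm_pos_iff.2 (by exact_mod_cast (Fact.out : p.Prime).ne_zero)

theorem prime_cast_ne_zero : (p : ℚ_[p]) ≠ 0 := by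
  exact_mod_cast (Fact.out : p.Prime).ne_zero

theorem norm_lt_one_iff_le_norm_prime {x : ℚ_[p]} : ‖x‖ < 1 ↔ ‖x‖ ≤ ‖(p : ℚ_[p])‖ := by
  rw [Padic.norm_p]
  have := Padic.norm_le_pow_iff_norm_lt_pow_add_one x (-1)
  simpa using this.symm

/-- Multiplication by a high power of `p` makes a norm small. -/
theorem exists_pow_mul_le (C : ℝ) {ε : ℝ} (hε : 0 < ε) :
    ∃ n : ℕ, ‖(p : ℚ_[p])‖ ^ n * C ≤ ε := by
  have h : Filter.Tendsto (fun n : ℕ => ‖(p : ℚ_[p])‖ ^ n * C) Filter.atTop (nhds (0 * C)) :=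
    (tendsto_pow_atTop_nhds_zero_of_lt_one (norm_nonneg _) Padic.norm_p_lt_one).mul_const C
  rw [zero_mul] at h
  exact ((h.eventually (gt_mem_nhds hε)).exists).imp fun n hn => hn.le

end Norm

/-! ### The maximal order as the valuation ring -/

section Order

variable {p : ℕ} [Fact p.Prime] {a b : ℚ}

/-- The valuation ring of the division algebra `B_p`. -/
def valuationOrder (hB : IsRamifiedAt p a b) : Subalgebra ℤ_[p] (Bp p a b) where
  carrier := {x | ‖nrd x‖ ≤ 1}
  mul_mem' hx hy := (norm_nrd_mul_le hx hy).trans_eq (one_mul 1)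
  add_mem' hx hy := norm_nrd_add_le hB hx hy
  algebraMap_mem' c := by
    change ‖nrd (algebraMap ℤ_[p] (Bp p a b) c)‖ ≤ 1
    rw [nrd_padicInt, norm_pow]
    exact pow_le_one₀ (norm_nonneg _) c.2

theorem exists_pow_smul_norm_nrd_le (x : Bp p a b) {ε : ℝ} (hε : 0 < ε) :
    ∃ n : ℕ, ‖nrd ((p : ℚ_[p]) ^ n • x)‖ ≤ ε := by
  obtain ⟨n, hn⟩ := exists_pow_mul_le (p := p) ‖nrd x‖ hε
  refine ⟨n, le_trans ?_ hn⟩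
  rw [nrd_smul, norm_mul, norm_pow, norm_pow]
  have h1 : ‖(p : ℚ_[p])‖ ^ n ≤ 1 := pow_le_one₀ (norm_nonneg _) Padic.norm_p_lt_one.le
  gcongr
  exact pow_le_of_le_one (by positivity) h1 two_ne_zero

/-- Each coordinate of $x$ is, up to a constant, the real part of $xe$ for a basis vector $e$, so
the trace bound makes coordinates bounded on the valuation ring. -/
theorem exists_norm_re_mul_le (hB : IsRamifiedAt p a b) (e : Bp p a b) {d : ℚ_[p]} (hd : d ≠ 0)
    (f : Bp p a b → ℚ_[p]) (hf : ∀ x, (x * e).re = d * f x) :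
    ∃ C : ℝ, ∀ x : Bp p a b, ‖nrd x‖ ≤ 1 → ‖f x‖ ≤ C := by
  -- The trace bound gives $s^2\le N$ with $N=|\mathrm{nrd}\,e|$; the cruder $s\le N+1$ avoids a
  -- square root.
  refine ⟨(‖nrd e‖ + 1) / ‖2 * d‖, fun x hx => ?_⟩
  have h2 : 0 < ‖2 * d‖ := norm_pos_iff.2 (mul_ne_zero two_ne_zero hd)
  rw [le_div_iff₀ h2, ← norm_mul]
  have h := (norm_two_re_sq_le hB (x * e)).trans (norm_nrd_mul_le hx le_rfl)
  rw [hf, one_mul] at h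
  rw [show f x * (2 * d) = 2 * (d * f x) by ring]
  nlinarith [norm_nonneg (2 * (d * f x)), norm_nonneg (nrd e)]

/-- Bounded coordinates place the valuation ring inside $p^{-n}$ times the $\mathbb Z_p$-span of
$1,i,j,k$, and submodules of finitely generated $\mathbb Z_p$-modules are finitely generated. -/
theorem valuationOrder_fg (hB : IsRamifiedAt p a b) :
    (Subalgebra.toSubmodule (valuationOrder hB)).FG := by
  have ha : (a : ℚ_[p]) ≠ 0 := by
    have := nrd_ne_zero hB (x := ⟨0, 1, 0, 0⟩) (fun h => by simpa using congrArg (·.imI) h)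
    simpa [nrd_eq] using this
  have hb : (b : ℚ_[p]) ≠ 0 := by
    have := nrd_ne_zero hB (x := ⟨0, 0, 1, 0⟩) (fun h => by simpa using congrArg (·.imJ) h)
    simpa [nrd_eq] using this
  obtain ⟨C₀, h₀⟩ := exists_norm_re_mul_le hB 1 one_ne_zero (fun x => x.re) (by simp)
  obtain ⟨C₁, h₁⟩ := exists_norm_re_mul_le hB ⟨0, 1, 0, 0⟩ ha (fun x => x.imI) (by simp)
  obtain ⟨C₂, h₂⟩ := exists_norm_re_mul_le hB ⟨0, 0, 1, 0⟩ hb (fun x => x.imJ) (by simp)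
  obtain ⟨C₃, h₃⟩ := exists_norm_re_mul_le hB ⟨0, 0, 0, 1⟩ (neg_ne_zero.2 (mul_ne_zero ha hb))
    (fun x => x.imK) (by simp)
  obtain ⟨n, hn⟩ := exists_pow_mul_le (p := p) (max (max C₀ C₁) (max C₂ C₃)) one_pos
  have key {q : ℚ_[p]} (hq : ‖q‖ ≤ max (max C₀ C₁) (max C₂ C₃)) : ‖(p : ℚ_[p]) ^ n * q‖ ≤ 1 := by
    rw [norm_mul, norm_pow]
    exact (mul_le_mul_of_nonneg_left hq (by positivity)).trans hn
  let e : Fin 4 → Bp p a b := fun i =>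
    ((p : ℚ_[p]) ^ n)⁻¹ • QuaternionAlgebra.basisOneIJK (a : ℚ_[p]) 0 (b : ℚ_[p]) i
  refine Submodule.FG.of_le (T := Submodule.span ℤ_[p] (Set.range e))
    (Submodule.fg_span (Set.finite_range e)) fun x hx => ?_
  have hx' : ‖nrd x‖ ≤ 1 := hx
  have hint (i : Fin 4) :
      ‖(p : ℚ_[p]) ^ n * (QuaternionAlgebra.basisOneIJK (a : ℚ_[p]) 0 (b : ℚ_[p])).repr x i‖ ≤ 1 := by
    apply key
    rw [QuaternionAlgebra.coe_basisOneIJK_repr]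
    fin_cases i
    · exact (h₀ x hx').trans (by simp)
    · exact (h₁ x hx').trans (by simp)
    · exact (h₂ x hx').trans (by simp)
    · exact (h₃ x hx').trans (by simp)
  let d : Fin 4 → ℤ_[p] := fun i => ⟨_, hint i⟩
  have hsum : x = ∑ i, d i • e i := by
    conv_lhs => rw [← (QuaternionAlgebra.basisOneIJK (a : ℚ_[p]) 0 (b : ℚ_[p])).sum_repr x]
    refine Finset.sum_congr rfl fun i _ => ?_
    rw [padicInt_smul, smul_smul]
    congr 1
    have : (p : ℚ_[p]) ^ n ≠ 0 := pow_ne_zero _ prime_cast_ne_zero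
    change _ = (p : ℚ_[p]) ^ n * _ * _
    field_simp
  rw [hsum]
  exact Submodule.sum_mem _ fun i _ => Submodule.smul_mem _ _ (Submodule.subset_span ⟨i, rfl⟩)

theorem valuationOrder_isLattice (hB : IsRamifiedAt p a b) :
    Submodule.IsLattice ℚ_[p] (Subalgebra.toSubmodule (valuationOrder hB)) where
  fg := valuationOrder_fg hB
  span_eq_top := by
    refine eq_top_iff.2 fun x _ => ?_
    obtain ⟨n, hn⟩ := exists_pow_smul_norm_nrd_le x one_pos
    have : x = ((p : ℚ_[p]) ^ n)⁻¹ • ((p : ℚ_[p]) ^ n • x) := by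
      rw [smul_smul, inv_mul_cancel₀ (pow_ne_zero _ prime_cast_ne_zero), one_smul]
    rw [this]
    exact Submodule.smul_mem _ _ (Submodule.subset_span hn)

theorem exists_norm_nrd_le_of_fg (hB : IsRamifiedAt p a b) {N : Submodule ℤ_[p] (Bp p a b)}
    (hN : N.FG) : ∃ C : ℝ, ∀ x ∈ N, ‖nrd x‖ ≤ C := by
  obtain ⟨s, rfl⟩ := hN
  refine ⟨∑ y ∈ s, ‖nrd y‖, fun x hx => ?_⟩
  induction hx using Submodule.span_induction with
  | mem y hy => exact Finset.single_le_sum (f := fun y => ‖nrd y‖) (fun _ _ => norm_nonneg _) hy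
  | zero => simpa using Finset.sum_nonneg fun y _ => norm_nonneg (nrd y)
  | add x y _ _ hx hy => exact norm_nrd_add_le hB hx hy
  | smul c x _ hx =>
    rw [padicInt_smul, nrd_smul, norm_mul, norm_pow]
    exact (mul_le_of_le_one_left (norm_nonneg _) (pow_le_one₀ (norm_nonneg _) c.2)).trans hx

/-- The norm is bounded on a finitely generated module, while the powers of an element with
$|\mathrm{nrd}\,x|>1$ would stay in $R$ with unbounded norm. -/
theorem norm_nrd_le_one_of_mem (hB : IsRamifiedAt p a b) {R : Subalgebra ℤ_[p] (Bp p a b)}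
    (hR : (Subalgebra.toSubmodule R).FG) {x : Bp p a b} (hx : x ∈ R) : ‖nrd x‖ ≤ 1 := by
  obtain ⟨C, hC⟩ := exists_norm_nrd_le_of_fg hB hR
  by_contra! h
  obtain ⟨n, hn⟩ := pow_unbounded_of_one_lt C h
  have hpow : ∀ m : ℕ, nrd (x ^ m) = nrd x ^ m := fun m => by
    induction m with
    | zero => simp
    | succ m ih => rw [pow_succ, nrd_mul, ih, pow_succ]
  have := hC (x ^ n) (pow_mem hx n)
  rw [hpow, norm_pow] at this
  exact absurd hn this.not_gt

/-- Every order lies in the valuation ring, which is itself an order; maximality then forces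
equality. -/
theorem IsMaximalOrder.mem_iff (hB : IsRamifiedAt p a b) {R : Subalgebra ℤ_[p] (Bp p a b)}
    (hR : IsMaximalOrder R) {x : Bp p a b} : x ∈ R ↔ ‖nrd x‖ ≤ 1 := by
  have hfg : (Subalgebra.toSubmodule R).FG := hR.prop.fg
  refine ⟨norm_nrd_le_one_of_mem hB hfg, fun hx => ?_⟩
  exact hR.le_of_ge (valuationOrder_isLattice hB)
    (fun y hy => norm_nrd_le_one_of_mem hB hfg hy) hx

end Order

/-! ### An element whose reduced norm has valuation one -/

section Uniformizer

variable {p : ℕ} [Fact p.Prime] {a b : ℚ}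

open MvPolynomial in
/-- A ternary quadratic form over a finite prime field has a nontrivial zero. -/
theorem exists_ternary_zero {F : Type*} [Field F] [Fintype F] (p : ℕ) [Fact p.Prime] [CharP F p]
    (n t : Fin 3 → F) :
    ∃ c : Fin 3 → F, c ≠ 0 ∧
      n 0 * c 0 ^ 2 + n 1 * c 1 ^ 2 + n 2 * c 2 ^ 2 +
        t 0 * (c 0 * c 1) + t 1 * (c 0 * c 2) + t 2 * (c 1 * c 2) = 0 := by
  classical
  let f : MvPolynomial (Fin 3) F :=
    C (n 0) * X 0 ^ 2 + C (n 1) * X 1 ^ 2 + C (n 2) * X 2 ^ 2 +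
      C (t 0) * (X 0 * X 1) + C (t 1) * (X 0 * X 2) + C (t 2) * (X 1 * X 2)
  have hf : f.IsHomogeneous 2 := by
    have hs (c : F) (i : Fin 3) : (C c * X i ^ 2).IsHomogeneous 2 := by
      simpa using (MvPolynomial.isHomogeneous_C (Fin 3) c).mul
        (MvPolynomial.isHomogeneous_X_pow i 2)
    have hm (c : F) (i j : Fin 3) : (C c * (X i * X j)).IsHomogeneous 2 := by
      simpa using (MvPolynomial.isHomogeneous_C (Fin 3) c).mul
        ((MvPolynomial.isHomogeneous_X F i).mul (MvPolynomial.isHomogeneous_X F j))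
    exact ((((hs _ _).add (hs _ _)).add (hs _ _)).add (hm _ _ _)).add (hm _ _ _) |>.add (hm _ _ _)
  -- Chevalley–Warning: the degree $2$ is less than the $3$ variables, so the number of zeros is
  -- divisible by $p$, and the zero vector is not the only one.
  have hdvd := char_dvd_card_solutions p (f := f) (hf.totalDegree_le.trans_lt (by simp))
  have h0 : MvPolynomial.eval 0 f = 0 := by simp [f]
  have hcard : 1 < Fintype.card {x : Fin 3 → F // MvPolynomial.eval x f = 0} :=
    (Fact.out : p.Prime).one_lt.trans_le
      (Nat.le_of_dvd (Fintype.card_pos_iff.2 ⟨⟨0, h0⟩⟩) hdvd)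
  obtain ⟨c, hc⟩ := Fintype.exists_ne_of_one_lt_card hcard ⟨0, h0⟩
  refine ⟨c.1, fun h => hc (Subtype.ext h), ?_⟩
  simpa [f] using c.2

theorem toZMod_eq_zero_iff {c : ℤ_[p]} : PadicInt.toZMod c = 0 ↔ (p : ℤ_[p]) ∣ c := by
  rw [← RingHom.mem_ker, PadicInt.ker_toZMod, PadicInt.maximalIdeal_eq_span_p,
    Ideal.mem_span_singleton]

/-- On three of the four basis vectors of the valuation ring, the norm form modulo $p$ is a ternary
quadratic form, hence isotropic. A lift $x$ of an isotropic vector has $p\mid\mathrm{nrd}\,x$ but is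
not divisible by $p$, which rules out $p^2\mid\mathrm{nrd}\,x$. -/
theorem exists_norm_nrd_eq (hB : IsRamifiedAt p a b) :
    ∃ x : Bp p a b, ‖nrd x‖ = ‖(p : ℚ_[p])‖ := by
  let O := Subalgebra.toSubmodule (valuationOrder hB)
  have : Submodule.IsLattice ℚ_[p] O := valuationOrder_isLattice hB
  have hrank : Module.finrank ℤ_[p] O = 4 := by
    have := Submodule.IsLattice.rank' ℚ_[p] O
    rw [Module.finrank, this, QuaternionAlgebra.rank_eq_four]
    simp
  let B := (Module.finBasisOfFinrankEq ℤ_[p] O hrank)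
  have hN (x : Bp p a b) (hx : x ∈ O) : ∃ n : ℤ_[p], (n : ℚ_[p]) = nrd x := ⟨⟨nrd x, hx⟩, rfl⟩
  have hT (x y : Bp p a b) (hx : x ∈ O) (hy : y ∈ O) :
      ∃ n : ℤ_[p], (n : ℚ_[p]) = 2 * (x * star y).re := by
    refine ⟨⟨2 * (x * star y).re, ?_⟩, rfl⟩
    have := (norm_two_re_sq_le hB (x * star y)).trans
      (norm_nrd_mul_le (r := 1) (s := 1) hx (by rw [nrd_star]; exact hy))
    rw [one_mul] at this
    exact (sq_le_one_iff₀ (norm_nonneg _)).1 this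
  obtain ⟨n₀, h₀⟩ := hN (B 0) (B 0).2
  obtain ⟨n₁, h₁⟩ := hN (B 1) (B 1).2
  obtain ⟨n₂, h₂⟩ := hN (B 2) (B 2).2
  obtain ⟨t₀, k₀⟩ := hT (B 0) (B 1) (B 0).2 (B 1).2
  obtain ⟨t₁, k₁⟩ := hT (B 0) (B 2) (B 0).2 (B 2).2
  obtain ⟨t₂, k₂⟩ := hT (B 1) (B 2) (B 1).2 (B 2).2
  obtain ⟨c, hc, h⟩ := exists_ternary_zero p
    (fun i => PadicInt.toZMod (![n₀, n₁, n₂] i)) (fun i => PadicInt.toZMod (![t₀, t₁, t₂] i))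
  obtain ⟨d, rfl⟩ : ∃ d : Fin 3 → ℤ_[p], c = fun i => PadicInt.toZMod (d i) := by
    choose d hd using fun i => ZMod.ringHom_surjective (PadicInt.toZMod (p := p)) (c i)
    exact ⟨d, funext fun i => (hd i).symm⟩
  set x : Bp p a b := d 0 • (B 0 : Bp p a b) + d 1 • (B 1 : Bp p a b) + d 2 • (B 2 : Bp p a b)
    with hx
  have hnx : nrd x = ((n₀ * d 0 ^ 2 + n₁ * d 1 ^ 2 + n₂ * d 2 ^ 2 +
      t₀ * (d 0 * d 1) + t₁ * (d 0 * d 2) + t₂ * (d 1 * d 2) : ℤ_[p]) : ℚ_[p]) := by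
    push_cast
    rw [h₀, h₁, h₂, k₀, k₁, k₂, hx]
    simp only [padicInt_smul, nrd_add, nrd_smul, add_mul, smul_mul_assoc,
      QuaternionAlgebra.star_smul, mul_smul_comm,
      QuaternionAlgebra.re_add, QuaternionAlgebra.re_smul, smul_eq_mul]
    ring
  have hdvd : (p : ℤ_[p]) ∣ n₀ * d 0 ^ 2 + n₁ * d 1 ^ 2 + n₂ * d 2 ^ 2 +
      t₀ * (d 0 * d 1) + t₁ * (d 0 * d 2) + t₂ * (d 1 * d 2) := by
    rw [← toZMod_eq_zero_iff]
    simpa using h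
  refine ⟨x, le_antisymm ?_ ?_⟩
  · obtain ⟨e, he⟩ := hdvd
    rw [hnx, he, PadicInt.coe_mul, norm_mul]
    exact mul_le_of_le_one_right (norm_nonneg _) e.2
  -- A strictly smaller norm is at most $|p|^2$, so $x/p$ lies in the valuation ring; comparing
  -- coordinates, all $d_i$ vanish modulo $p$.
  · by_contra! hlt
    have hp := norm_prime_pos (p := p)
    have hy : ‖nrd ((p : ℚ_[p])⁻¹ • x)‖ ≤ 1 := by
      have : ‖(p : ℚ_[p])⁻¹ * nrd x‖ < 1 := by
        rw [norm_mul, norm_inv, inv_mul_lt_iff₀ hp, mul_one]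
        exact hlt
      have := norm_lt_one_iff_le_norm_prime.1 this
      rw [norm_mul, norm_inv, inv_mul_le_iff₀ hp] at this
      rw [nrd_smul, norm_mul, norm_pow, norm_inv, inv_pow, inv_mul_le_iff₀ (by positivity)]
      linarith [sq ‖(p : ℚ_[p])‖]
    let y : O := ⟨_, hy⟩
    have hxy : (p : ℤ_[p]) • y = d 0 • B 0 + d 1 • B 1 + d 2 • B 2 := by
      apply Subtype.ext
      change (p : ℤ_[p]) • ((p : ℚ_[p])⁻¹ • x) = x
      rw [padicInt_smul, smul_smul, PadicInt.coe_natCast, mul_inv_cancel₀ prime_cast_ne_zero,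
        one_smul]
    apply hc
    have hcoord := congrArg (fun z => (B.repr z : Fin 4 → ℤ_[p])) hxy
    simp only [map_smul, map_add, Module.Basis.repr_self] at hcoord
    funext i
    refine toZMod_eq_zero_iff.2 ⟨B.repr y i.castSucc, ?_⟩
    have := congrFun hcoord i.castSucc
    fin_cases i <;> simpa [Finsupp.single_apply] using this.symm

end Uniformizer

/-! ### Similitudes of the form $H$ -/

section Adjoint

variable {p : ℕ} [Fact p.Prime] {a b : ℚ}

/-- The adjoint of `X` with respect to the hermitian form `H`. -/
noncomputable def formAdjoint (X : M2 p a b) : M2 p a b := H p a b * Xᴴ * H p a b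

theorem H_mul_H : H p a b * H p a b = 1 := by
  simp [H, Matrix.one_fin_two]

theorem H_conjTranspose : (H p a b)ᴴ = H p a b := by
  ext1 i j
  fin_cases i <;> fin_cases j <;> simp [H]

theorem formAdjoint_apply (X : M2 p a b) (i j : Fin 2) :
    formAdjoint X i j = star (X j.rev i.rev) := by
  fin_cases i <;> fin_cases j <;>
    simp [formAdjoint, H, Matrix.mul_apply, Matrix.vecMul, dotProduct, Fin.sum_univ_two, Fin.rev]

theorem formAdjoint_mul (X Y : M2 p a b) :
    formAdjoint (X * Y) = formAdjoint Y * formAdjoint X := by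
  calc formAdjoint (X * Y) = H p a b * Yᴴ * 1 * Xᴴ * H p a b := by
        simp only [formAdjoint, Matrix.conjTranspose_mul, Matrix.mul_one, Matrix.mul_assoc]
    _ = _ := by
        rw [← H_mul_H]
        simp only [formAdjoint, Matrix.mul_assoc]

@[simp] theorem formAdjoint_formAdjoint (X : M2 p a b) : formAdjoint (formAdjoint X) = X := by
  ext1 i j
  simp [formAdjoint_apply]

@[simp] theorem formAdjoint_smul (c : ℚ_[p]) (X : M2 p a b) :
    formAdjoint (c • X) = c • formAdjoint X := by
  ext1 i j
  simp [formAdjoint_apply, QuaternionAlgebra.star_smul]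

/-- From $\xi^*\xi=H$ and $H^2=1$ come $H\xi^*=\xi^{-1}$ and $(\xi^{-1})^*H=\xi$. Conjugation by
$\xi$ thus exchanges the two involutions. -/
theorem formAdjoint_conj {ξ : (M2 p a b)ˣ}
    (hξ : (ξ : M2 p a b)ᴴ * (ξ : M2 p a b) = H p a b) (A : M2 p a b) :
    formAdjoint (((ξ⁻¹ : (M2 p a b)ˣ) : M2 p a b) * A * (ξ : M2 p a b)) =
      ((ξ⁻¹ : (M2 p a b)ˣ) : M2 p a b) * Aᴴ * (ξ : M2 p a b) := by
  have h1 : H p a b * (ξ : M2 p a b)ᴴ = ((ξ⁻¹ : (M2 p a b)ˣ) : M2 p a b) := by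
    refine Units.eq_inv_of_mul_eq_one_right ?_
    rw [Matrix.mul_assoc, hξ, H_mul_H]
  have h2 : ((ξ⁻¹ : (M2 p a b)ˣ) : M2 p a b)ᴴ * H p a b = ξ := by
    rw [← h1, Matrix.conjTranspose_mul, Matrix.conjTranspose_conjTranspose, H_conjTranspose,
      Matrix.mul_assoc, H_mul_H, Matrix.mul_one]
  calc _ = (H p a b * (ξ : M2 p a b)ᴴ) * Aᴴ * (((ξ⁻¹ : (M2 p a b)ˣ) : M2 p a b)ᴴ * H p a b) := by
        simp only [formAdjoint, Matrix.conjTranspose_mul, Matrix.mul_assoc]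
    _ = _ := by rw [h1, h2]

/-- `h` is a similitude of the form `H` with multiplier `ν`. -/
def IsSimilitude (h : (M2 p a b)ˣ) (ν : ℚ_[p]) : Prop :=
  ν ≠ 0 ∧ formAdjoint (h : M2 p a b) * (h : M2 p a b) = ν • 1

theorem IsSimilitude.formAdjoint_eq {h : (M2 p a b)ˣ} {ν : ℚ_[p]} (hh : IsSimilitude h ν) :
    formAdjoint (h : M2 p a b) = ν • ((h⁻¹ : (M2 p a b)ˣ) : M2 p a b) := by
  calc formAdjoint (h : M2 p a b) = formAdjoint (h : M2 p a b) * h * (h⁻¹ : (M2 p a b)ˣ) := by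
        rw [Matrix.mul_assoc, Units.mul_inv, Matrix.mul_one]
    _ = _ := by rw [hh.2, Matrix.smul_mul, Matrix.one_mul]

theorem IsSimilitude.inv_eq {h : (M2 p a b)ˣ} {ν : ℚ_[p]} (hh : IsSimilitude h ν) :
    ((h⁻¹ : (M2 p a b)ˣ) : M2 p a b) = ν⁻¹ • formAdjoint (h : M2 p a b) := by
  rw [hh.formAdjoint_eq, smul_smul, inv_mul_cancel₀ hh.1, one_smul]

theorem IsSimilitude.inv {h : (M2 p a b)ˣ} {ν : ℚ_[p]} (hh : IsSimilitude h ν) :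
    IsSimilitude h⁻¹ ν⁻¹ := by
  refine ⟨inv_ne_zero hh.1, ?_⟩
  have h1 : formAdjoint ((h⁻¹ : (M2 p a b)ˣ) : M2 p a b) = ν⁻¹ • (h : M2 p a b) := by
    rw [hh.inv_eq, formAdjoint_smul, formAdjoint_formAdjoint]
  rw [h1, Matrix.smul_mul, Units.mul_inv]

theorem IsSimilitude.mul {h k : (M2 p a b)ˣ} {ν μ : ℚ_[p]} (hh : IsSimilitude h ν)
    (hk : IsSimilitude k μ) : IsSimilitude (h * k) (ν * μ) := by
  refine ⟨mul_ne_zero hh.1 hk.1, ?_⟩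
  rw [Units.val_mul, formAdjoint_mul, Matrix.mul_assoc, ← Matrix.mul_assoc _ (h : M2 p a b), hh.2,
    Matrix.smul_mul, Matrix.one_mul, Matrix.mul_smul, hk.2, smul_smul]

theorem exists_isSimilitude {ξ : (M2 p a b)ˣ}
    (hξ : (ξ : M2 p a b)ᴴ * (ξ : M2 p a b) = H p a b) (g : GU2 p a b) :
    ∃ ν, IsSimilitude (ξ⁻¹ * (g : (M2 p a b)ˣ) * ξ) ν := by
  obtain ⟨ν, hν, hg⟩ := g.2
  refine ⟨ν, hν, ?_⟩
  rw [Units.val_mul, Units.val_mul, formAdjoint_conj hξ]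
  simp only [Matrix.mul_assoc]
  rw [Units.mul_inv_cancel_left, ← Matrix.mul_assoc _ _ (ξ : M2 p a b), hg, Matrix.smul_mul,
    Matrix.one_mul, Matrix.mul_smul, Units.inv_mul]

end Adjoint

/-! ### Graded balls and the lattice as the self-adjoint unit ball -/

section Ball

variable {p : ℕ} [Fact p.Prime] {a b : ℚ}

/-- Matrices whose entries have norm at most `ρ`, relative to the grading of the endomorphism
ring of the column lattice with entries in the maximal ideal and in the maximal order. -/
def gradedBall (p : ℕ) [Fact p.Prime] (a b : ℚ) (ρ : ℝ) : Set (M2 p a b) :=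
  {X | ∀ i j, ‖nrd (X i j)‖ ≤ ρ * ‖(p : ℚ_[p])‖ ^ ((j : ℤ) - (i : ℤ))}

theorem mem_gradedBall {X : M2 p a b} {ρ : ℝ} : X ∈ gradedBall p a b ρ ↔
    (‖nrd (X 0 0)‖ ≤ ρ ∧ ‖nrd (X 0 1)‖ ≤ ρ * ‖(p : ℚ_[p])‖) ∧
      ‖nrd (X 1 0)‖ ≤ ρ * ‖(p : ℚ_[p])‖⁻¹ ∧ ‖nrd (X 1 1)‖ ≤ ρ := by
  simp [gradedBall, Fin.forall_fin_two]

/-- The weights $|p|^{j-i}$ are multiplicative along $i\to k\to j$, and the norm is ultrametric. -/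
theorem gradedBall_mul (hB : IsRamifiedAt p a b) {X Y : M2 p a b} {ρ σ : ℝ}
    (hX : X ∈ gradedBall p a b ρ) (hY : Y ∈ gradedBall p a b σ) :
    X * Y ∈ gradedBall p a b (ρ * σ) := by
  intro i j
  have h (k : Fin 2) : ‖nrd (X i k * Y k j)‖ ≤ ρ * σ * ‖(p : ℚ_[p])‖ ^ ((j : ℤ) - (i : ℤ)) := by
    refine (norm_nrd_mul_le (hX i k) (hY k j)).trans_eq ?_
    rw [show (j : ℤ) - i = (k - i) + (j - k) by ring, zpow_add₀ norm_prime_pos.ne']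
    ring
  rw [Matrix.mul_apply, Fin.sum_univ_two]
  exact norm_nrd_add_le hB (h 0) (h 1)

theorem gradedBall_smul {X : M2 p a b} {ρ : ℝ} (c : ℚ_[p]) (hX : X ∈ gradedBall p a b ρ) :
    c • X ∈ gradedBall p a b (‖c‖ ^ 2 * ρ) := by
  intro i j
  rw [Matrix.smul_apply, nrd_smul, norm_mul, norm_pow, mul_assoc]
  gcongr
  exact hX i j

theorem gradedBall_formAdjoint {X : M2 p a b} {ρ : ℝ} (hX : X ∈ gradedBall p a b ρ) :
    formAdjoint X ∈ gradedBall p a b ρ := by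
  rw [mem_gradedBall] at hX ⊢
  simp only [formAdjoint_apply, nrd_star]
  exact ⟨⟨hX.2.2, hX.1.2⟩, hX.2.1, hX.1.1⟩

/-- The inverse is $\nu^{-1}h^\dagger$, and the norm scales quadratically:
$|\nu^{-1}|^2|\nu|=|\nu^{-1}|$. -/
theorem IsSimilitude.inv_mem_gradedBall {h : (M2 p a b)ˣ} {ν : ℚ_[p]} (hh : IsSimilitude h ν)
    (hb : (h : M2 p a b) ∈ gradedBall p a b ‖ν‖) :
    ((h⁻¹ : (M2 p a b)ˣ) : M2 p a b) ∈ gradedBall p a b ‖ν⁻¹‖ := by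
  rw [hh.inv_eq]
  convert gradedBall_smul ν⁻¹ (gradedBall_formAdjoint hb) using 2
  have := norm_ne_zero_iff.2 hh.1
  rw [norm_inv]
  field_simp

theorem norm_le_of_sq_le {y : ℚ_[p]} (h : ‖y ^ 2‖ ≤ ‖(p : ℚ_[p])‖) : ‖y‖ ≤ ‖(p : ℚ_[p])‖ := by
  rw [← norm_lt_one_iff_le_norm_prime]
  rw [norm_pow] at h
  exact (sq_lt_one_iff₀ (norm_nonneg _)).1 (h.trans_lt Padic.norm_p_lt_one)

/-- Valuations are integers: $2v(y)\ge-1$ forces $v(y)\ge0$. This follows from the preceding lemma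
applied to $py$. -/
theorem norm_le_one_of_sq_le {y : ℚ_[p]} (h : ‖y ^ 2‖ ≤ ‖(p : ℚ_[p])‖⁻¹) : ‖y‖ ≤ 1 := by
  have hq := norm_prime_pos (p := p)
  have : ‖p * y‖ ≤ ‖(p : ℚ_[p])‖ := by
    apply norm_le_of_sq_le
    rw [mul_pow, norm_mul, norm_pow, sq, mul_assoc]
    refine mul_le_of_le_one_right hq.le ?_
    exact (mul_le_mul_of_nonneg_left h hq.le).trans_eq (mul_inv_cancel₀ hq.ne')
  rw [norm_mul] at this
  exact (mul_le_iff_le_one_right hq).1 this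

theorem eq_algebraMap_of_star_eq {x : Bp p a b} (hx : star x = x) :
    x = algebraMap ℚ_[p] (Bp p a b) x.re := by
  have h (q : ℚ_[p]) (hq : -q = q) : q = 0 := by
    have : (2 : ℚ_[p]) * q = 0 := by linear_combination -hq
    simpa using this
  rw [QuaternionAlgebra.algebraMap_eq]
  ext
  · rfl
  · exact h _ (by simpa using congrArg (·.imI) hx)
  · exact h _ (by simpa using congrArg (·.imJ) hx)
  · exact h _ (by simpa using congrArg (·.imK) hx)

theorem star_padicInt (c : ℤ_[p]) :
    star (algebraMap ℤ_[p] (Bp p a b) c) = algebraMap ℤ_[p] (Bp p a b) c := by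
  rw [IsScalarTower.algebraMap_apply ℤ_[p] ℚ_[p] (Bp p a b), QuaternionAlgebra.algebraMap_eq]
  ext <;> simp

/-- Self-adjointness makes the off-diagonal entries scalars $s',t'$ and the diagonal entries
conjugate. The norm of a scalar is its square, so the ball conditions $|s'|^2\le|p|$ and
$|t'|^2\le|p|^{-1}$ sharpen, by integrality of valuations, to $s'\in p\mathbb Z_p$ and $t'\in\mathbb
Z_p$. -/
theorem mem_latticeTilde_iff (hB : IsRamifiedAt p a b) {R : Subalgebra ℤ_[p] (Bp p a b)}
    (hR : IsMaximalOrder R) {A : M2 p a b} :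
    A ∈ latticeTilde R ↔ formAdjoint A = A ∧ A ∈ gradedBall p a b 1 := by
  have hq := norm_prime_pos (p := p)
  have hq1 := Padic.norm_p_lt_one (p := p)
  constructor
  · rintro ⟨r, hr, s, t, rfl⟩
    rw [hR.mem_iff hB] at hr
    have hs : ‖(s : ℚ_[p])‖ ^ 2 ≤ 1 := pow_le_one₀ (norm_nonneg _) s.2
    have ht : ‖(t : ℚ_[p])‖ ^ 2 ≤ 1 := pow_le_one₀ (norm_nonneg _) t.2
    constructor
    · ext1 i j
      rw [formAdjoint_apply]
      fin_cases i <;> fin_cases j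
      · exact star_star r
      · exact star_padicInt _
      · exact star_padicInt _
      · rfl
    · rw [mem_gradedBall]
      refine ⟨⟨hr, ?_⟩, ?_, ?_⟩
      · change ‖nrd (algebraMap ℤ_[p] (Bp p a b) (p * s))‖ ≤ _
        rw [nrd_padicInt, PadicInt.coe_mul, PadicInt.coe_natCast, norm_pow, norm_mul, mul_pow,
          one_mul]
        refine (mul_le_of_le_one_right (by positivity) hs).trans ?_
        exact pow_le_of_le_one hq.le hq1.le two_ne_zero
      · change ‖nrd (algebraMap ℤ_[p] (Bp p a b) t)‖ ≤ _
        rw [nrd_padicInt, norm_pow, one_mul]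
        exact ht.trans (one_le_inv_iff₀.2 ⟨hq, hq1.le⟩)
      · change ‖nrd (star r)‖ ≤ 1
        rwa [nrd_star]
  · rintro ⟨hA, hb⟩
    rw [mem_gradedBall] at hb
    have hA' (i j : Fin 2) : star (A j.rev i.rev) = A i j := by
      rw [← formAdjoint_apply, hA]
    obtain ⟨s, hs⟩ : ∃ s, A 0 1 = algebraMap ℚ_[p] (Bp p a b) s :=
      ⟨_, eq_algebraMap_of_star_eq (hA' 0 1)⟩
    obtain ⟨t, ht⟩ : ∃ t, A 1 0 = algebraMap ℚ_[p] (Bp p a b) t :=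
      ⟨_, eq_algebraMap_of_star_eq (hA' 1 0)⟩
    have hs' : ‖(p : ℚ_[p])⁻¹ * s‖ ≤ 1 := by
      rw [norm_mul, norm_inv, inv_mul_le_iff₀ hq, mul_one]
      apply norm_le_of_sq_le
      rw [← nrd_algebraMap (a := a) (b := b), ← hs, ← one_mul ‖(p : ℚ_[p])‖]
      exact hb.1.2
    have ht' : ‖t‖ ≤ 1 := by
      have h := hb.2.1
      rw [ht, nrd_algebraMap, one_mul] at h
      exact norm_le_one_of_sq_le h
    refine ⟨A 0 0, (hR.mem_iff hB).2 hb.1.1, ⟨_, hs'⟩, ⟨t, ht'⟩, ?_⟩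
    ext1 i j
    fin_cases i <;> fin_cases j
    · rfl
    · change A 0 1 = algebraMap ℤ_[p] (Bp p a b) _
      rw [hs, IsScalarTower.algebraMap_apply ℤ_[p] ℚ_[p] (Bp p a b)]
      congr 1
      change s = (p : ℚ_[p]) * ((p : ℚ_[p])⁻¹ * s)
      rw [mul_inv_cancel_left₀ prime_cast_ne_zero]
    · exact ht
    · exact (hA' 1 1).symm

end Ball

/-! ### The stabiliser of the lattice in terms of the multiplier -/

section Stabilizer

variable {p : ℕ} [Fact p.Prime] {a b : ℚ}

/-- Conjugation by a similitude commutes with the adjoint, and the radii of the three factors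
multiply to $|\nu|\cdot1\cdot|\nu^{-1}|=1$. -/
theorem IsSimilitude.conj_mem_latticeTilde (hB : IsRamifiedAt p a b)
    {R : Subalgebra ℤ_[p] (Bp p a b)} (hR : IsMaximalOrder R) {h : (M2 p a b)ˣ} {ν : ℚ_[p]}
    (hh : IsSimilitude h ν) (hb : (h : M2 p a b) ∈ gradedBall p a b ‖ν‖) {A : M2 p a b}
    (hA : A ∈ latticeTilde R) :
    (h : M2 p a b) * A * ((h⁻¹ : (M2 p a b)ˣ) : M2 p a b) ∈ latticeTilde R := by
  rw [mem_latticeTilde_iff hB hR] at hA ⊢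
  constructor
  · rw [formAdjoint_mul, formAdjoint_mul, hA.1, hh.inv.formAdjoint_eq, inv_inv, hh.formAdjoint_eq,
      Matrix.smul_mul, Matrix.mul_smul, Matrix.mul_smul, smul_smul, inv_mul_cancel₀ hh.1, one_smul,
      Matrix.mul_assoc]
  · have := gradedBall_mul hB (gradedBall_mul hB hb hA.2) (hh.inv_mem_gradedBall hb)
    rwa [mul_one, ← norm_mul, mul_inv_cancel₀ hh.1, norm_one] at this

theorem IsSimilitude.conj_mem_latticeTilde_iff (hB : IsRamifiedAt p a b)
    {R : Subalgebra ℤ_[p] (Bp p a b)} (hR : IsMaximalOrder R) {h : (M2 p a b)ˣ} {ν : ℚ_[p]}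
    (hh : IsSimilitude h ν) (hb : (h : M2 p a b) ∈ gradedBall p a b ‖ν‖) (A : M2 p a b) :
    (h : M2 p a b) * A * ((h⁻¹ : (M2 p a b)ˣ) : M2 p a b) ∈ latticeTilde R ↔
      A ∈ latticeTilde R := by
  refine ⟨fun hA => ?_, hh.conj_mem_latticeTilde hB hR hb⟩
  have := hh.inv.conj_mem_latticeTilde hB hR (hh.inv_mem_gradedBall hb) hA
  simpa [← Matrix.mul_assoc, Matrix.mul_assoc _ ((h⁻¹ : (M2 p a b)ˣ) : M2 p a b)] using this

theorem IsSimilitude.conj_apply {h : (M2 p a b)ˣ} {ν : ℚ_[p]} (hh : IsSimilitude h ν)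
    (A : M2 p a b) (i j : Fin 2) :
    ((h : M2 p a b) * A * ((h⁻¹ : (M2 p a b)ˣ) : M2 p a b)) i j =
      ν⁻¹ • ∑ l, (∑ k, (h : M2 p a b) i k * A k l) * star ((h : M2 p a b) j.rev l.rev) := by
  rw [hh.inv_eq, Matrix.mul_smul, Matrix.smul_apply, Matrix.mul_apply]
  simp only [Matrix.mul_apply, formAdjoint_apply]

theorem lower_mem_latticeTilde (R : Subalgebra ℤ_[p] (Bp p a b)) :
    !![0, 0; 1, 0] ∈ latticeTilde R :=
  ⟨0, zero_mem R, 0, 1, by simp⟩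

theorem upper_mem_latticeTilde (R : Subalgebra ℤ_[p] (Bp p a b)) :
    !![0, algebraMap ℚ_[p] (Bp p a b) p; 0, 0] ∈ latticeTilde R :=
  ⟨0, zero_mem R, 1, 0, by simp⟩

/-- A similitude that normalizes the lattice is bounded by its multiplier. -/
theorem IsSimilitude.mem_gradedBall_of_conj (hB : IsRamifiedAt p a b)
    {R : Subalgebra ℤ_[p] (Bp p a b)} (hR : IsMaximalOrder R) {h : (M2 p a b)ˣ} {ν : ℚ_[p]}
    (hh : IsSimilitude h ν)
    (hconj : ∀ A ∈ latticeTilde R,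
      (h : M2 p a b) * A * ((h⁻¹ : (M2 p a b)ˣ) : M2 p a b) ∈ latticeTilde R) :
    (h : M2 p a b) ∈ gradedBall p a b ‖ν‖ := by
  have hq := norm_prime_pos (p := p)
  have hν := norm_pos_iff.2 hh.1
  -- Two test matrices suffice. The off-diagonal entries of the conjugate of $E_{21}$ are
  -- $\nu^{-1}\mathrm{nrd}$ of the second-column entries of $h$; those of the conjugate of $pE_{12}$
  -- are $p\nu^{-1}\mathrm{nrd}$ of the first-column entries.
  have hl := (mem_gradedBall.1 ((mem_latticeTilde_iff hB hR).1
    (hconj _ (lower_mem_latticeTilde R))).2)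
  have hu := (mem_gradedBall.1 ((mem_latticeTilde_iff hB hR).1
    (hconj _ (upper_mem_latticeTilde R))).2)
  have e (x : Bp p a b) : ‖nrd (ν⁻¹ • (x * star x))‖ = ‖(ν⁻¹ * nrd x) ^ 2‖ := by
    rw [nrd_smul, nrd_mul, nrd_star]
    ring_nf
  have e' (x : Bp p a b) :
      ‖nrd (ν⁻¹ • (x * algebraMap ℚ_[p] (Bp p a b) p * star x))‖ = ‖(p * (ν⁻¹ * nrd x)) ^ 2‖ := by
    rw [nrd_smul, nrd_mul, nrd_mul, nrd_star, nrd_algebraMap]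
    ring_nf
  have hl1 := hl.1.2
  have hl2 := hl.2.1
  have hu1 := hu.1.2
  have hu2 := hu.2.1
  rw [hh.conj_apply] at hl1 hl2 hu1 hu2
  simp only [Fin.sum_univ_two, Matrix.of_apply, Matrix.cons_val_zero, Matrix.cons_val_one,
    Matrix.cons_val', Matrix.cons_val_fin_one, mul_zero, zero_mul, add_zero, zero_add, mul_one,
    Fin.rev_zero, Fin.reduceLast, Fin.reduceRev, one_mul, e, e'] at hl1 hl2 hu1 hu2
  -- These entries are scalars, so their norms are squares and the bounds sharpen to exactly those
  -- defining the ball of radius $|\nu|$.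
  replace hl1 := norm_le_of_sq_le hl1
  replace hl2 := norm_le_one_of_sq_le hl2
  replace hu1 := norm_le_of_sq_le hu1
  replace hu2 := norm_le_one_of_sq_le hu2
  simp only [norm_mul, norm_inv] at hl1 hl2 hu1 hu2
  rw [mem_gradedBall]
  rw [inv_mul_le_iff₀ hν] at hl1 hl2
  rw [mul_le_iff_le_one_right hq, inv_mul_le_iff₀ hν, mul_one] at hu1
  rw [← le_inv_mul_iff₀ hq, inv_mul_le_iff₀ hν, mul_one] at hu2
  exact ⟨⟨hu1, hl1⟩, hu2, by rwa [mul_one] at hl2⟩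

theorem mem_latticeU_iff {R : Subalgebra ℤ_[p] (Bp p a b)} {ξ : (M2 p a b)ˣ} {A : M2 p a b} :
    A ∈ latticeU R ξ ↔
      ((ξ⁻¹ : (M2 p a b)ˣ) : M2 p a b) * A * (ξ : M2 p a b) ∈ latticeTilde R := by
  rw [mem_latticeU]
  constructor
  · rintro ⟨C, hC, rfl⟩
    simpa [Matrix.mul_assoc] using hC
  · intro h
    exact ⟨_, h, by simp [Matrix.mul_assoc]⟩

theorem mem_stab_iff {R : Subalgebra ℤ_[p] (Bp p a b)} {ξ : (M2 p a b)ˣ} {g : GU2 p a b} :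
    g ∈ stab (latticeU R ξ) ↔ ∀ A, ((ξ⁻¹ * (g : (M2 p a b)ˣ) * ξ : (M2 p a b)ˣ) : M2 p a b) * A *
      (((ξ⁻¹ * (g : (M2 p a b)ˣ) * ξ)⁻¹ : (M2 p a b)ˣ) : M2 p a b) ∈ latticeTilde R ↔
        A ∈ latticeTilde R := by
  change (∀ A, _ ∈ latticeU R ξ ↔ A ∈ latticeU R ξ) ↔ _
  simp only [mem_latticeU_iff]
  constructor
  · intro h A
    have := h ((ξ : M2 p a b) * A * ((ξ⁻¹ : (M2 p a b)ˣ) : M2 p a b))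
    simpa [mul_inv_rev, Matrix.mul_assoc] using this
  · intro h A
    have := h (((ξ⁻¹ : (M2 p a b)ˣ) : M2 p a b) * A * (ξ : M2 p a b))
    simpa [mul_inv_rev, Matrix.mul_assoc] using this

theorem mem_stab_iff_mem_gradedBall (hB : IsRamifiedAt p a b)
    {R : Subalgebra ℤ_[p] (Bp p a b)} (hR : IsMaximalOrder R) {ξ : (M2 p a b)ˣ}
    {g : GU2 p a b} {ν : ℚ_[p]} (hν : IsSimilitude (ξ⁻¹ * (g : (M2 p a b)ˣ) * ξ) ν) :
    g ∈ stab (latticeU R ξ) ↔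
      ((ξ⁻¹ * (g : (M2 p a b)ˣ) * ξ : (M2 p a b)ˣ) : M2 p a b) ∈ gradedBall p a b ‖ν‖ := by
  rw [mem_stab_iff]
  exact ⟨fun h => hν.mem_gradedBall_of_conj hB hR fun A hA => (h A).2 hA,
    fun h => hν.conj_mem_latticeTilde_iff hB hR h⟩

end Stabilizer

/-! ### The group $K_p^-$ in terms of the multiplier -/

section ColumnLattice

variable {p : ℕ} [Fact p.Prime] {a b : ℚ}

/-- The column lattice with entries in the maximal ideal and in the maximal order. -/
def columnLattice (p : ℕ) [Fact p.Prime] (a b : ℚ) : Set (Fin 2 → Bp p a b) :=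
  {v | ‖nrd (v 0)‖ ≤ ‖(p : ℚ_[p])‖ ∧ ‖nrd (v 1)‖ ≤ 1}

theorem mem_L_iff (hB : IsRamifiedAt p a b) {R : Subalgebra ℤ_[p] (Bp p a b)}
    (hR : IsMaximalOrder R) {ξ : (M2 p a b)ˣ} {v : Fin 2 → Bp p a b} :
    v ∈ L R ξ ↔ ((ξ⁻¹ : (M2 p a b)ˣ) : M2 p a b) *ᵥ v ∈ columnLattice p a b := by
  have hq := norm_prime_pos (p := p)
  constructor
  · rintro ⟨x, hx, y, hy, ⟨c, hc⟩, rfl⟩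
    rw [Matrix.mulVec_mulVec, Units.inv_mul, Matrix.one_mulVec]
    refine ⟨?_, (hR.mem_iff hB).1 hy⟩
    change ‖nrd x‖ ≤ _
    rw [hc, norm_mul]
    exact mul_le_of_le_one_right hq.le c.2
  · rintro ⟨h0, h1⟩
    refine ⟨_, (hR.mem_iff hB).2 (h0.trans Padic.norm_p_lt_one.le), _, (hR.mem_iff hB).2 h1,
      ⟨⟨(p : ℚ_[p])⁻¹ * nrd _, ?_⟩, (mul_inv_cancel_left₀ prime_cast_ne_zero _).symm⟩, ?_⟩
    · rwa [norm_mul, norm_inv, inv_mul_le_iff₀ hq, mul_one]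
    · have : ∀ w : Fin 2 → Bp p a b, ![w 0, w 1] = w := fun w => by
        ext1 i; fin_cases i <;> rfl
      rw [this, Matrix.mulVec_mulVec, Units.mul_inv, Matrix.one_mulVec]

theorem mulVec_mem_columnLattice (hB : IsRamifiedAt p a b) {X : M2 p a b}
    (hX : X ∈ gradedBall p a b 1) {v : Fin 2 → Bp p a b} (hv : v ∈ columnLattice p a b) :
    X *ᵥ v ∈ columnLattice p a b := by
  have hq := norm_prime_pos (p := p)
  rw [mem_gradedBall] at hX
  have h00 := norm_nrd_mul_le hX.1.1 hv.1
  have h01 := norm_nrd_mul_le hX.1.2 hv.2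
  have h10 := norm_nrd_mul_le hX.2.1 hv.1
  have h11 := norm_nrd_mul_le hX.2.2 hv.2
  rw [one_mul] at h00
  rw [one_mul, mul_one] at h01
  rw [one_mul, inv_mul_cancel₀ hq.ne'] at h10
  rw [one_mul] at h11
  simp only [columnLattice, Set.mem_ofPred_eq, Matrix.mulVec, dotProduct, Fin.sum_univ_two]
  exact ⟨norm_nrd_add_le hB h00 h01, norm_nrd_add_le hB h10 h11⟩

/-- The vectors $(\pi,0)$ and $(0,1)$ read off the two columns. The uniformizer $\pi$ is needed for
sharpness: testing with $p$, whose norm has valuation $2$, would lose a factor $|p|$. -/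
theorem mem_gradedBall_of_mulVec (hB : IsRamifiedAt p a b) {X : M2 p a b}
    (hX : ∀ v ∈ columnLattice p a b, X *ᵥ v ∈ columnLattice p a b) : X ∈ gradedBall p a b 1 := by
  have hq := norm_prime_pos (p := p)
  obtain ⟨π, hπ⟩ := exists_norm_nrd_eq hB
  have h0 := hX ![π, 0] (by simp [columnLattice, hπ])
  have h1 := hX ![0, 1] (by simp [columnLattice])
  simp only [columnLattice, Set.mem_ofPred_eq, Matrix.mulVec, dotProduct, Fin.sum_univ_two,
    Matrix.cons_val_zero, Matrix.cons_val_one, mul_zero, mul_one, add_zero, zero_add, nrd_mul,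
    norm_mul, hπ] at h0 h1
  rw [mul_le_iff_le_one_left hq, ← le_mul_inv_iff₀ hq] at h0
  rw [mem_gradedBall, one_mul]
  exact ⟨⟨h0.1, h1.1⟩, h0.2, h1.2⟩

theorem mem_Kminus_iff (hB : IsRamifiedAt p a b) {R : Subalgebra ℤ_[p] (Bp p a b)}
    (hR : IsMaximalOrder R) {ξ : (M2 p a b)ˣ} {g : GU2 p a b} :
    g ∈ Kminus R ξ ↔ ∀ v, ((ξ⁻¹ * (g : (M2 p a b)ˣ) * ξ : (M2 p a b)ˣ) : M2 p a b) *ᵥ v ∈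
      columnLattice p a b ↔ v ∈ columnLattice p a b := by
  change (∀ v, _ ∈ L R ξ ↔ v ∈ L R ξ) ↔ _
  have key (v : Fin 2 → Bp p a b) :
      ((ξ⁻¹ : (M2 p a b)ˣ) : M2 p a b) *ᵥ (((g : (M2 p a b)ˣ) : M2 p a b) *ᵥ v) =
        ((ξ⁻¹ * (g : (M2 p a b)ˣ) * ξ : (M2 p a b)ˣ) : M2 p a b) *ᵥ
          (((ξ⁻¹ : (M2 p a b)ˣ) : M2 p a b) *ᵥ v) := by
    rw [Matrix.mulVec_mulVec, Matrix.mulVec_mulVec, Units.val_mul, Units.val_mul,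
      Units.mul_inv_cancel_right]
  have hinv (v : Fin 2 → Bp p a b) :
      ((ξ⁻¹ : (M2 p a b)ˣ) : M2 p a b) *ᵥ ((ξ : M2 p a b) *ᵥ v) = v := by
    rw [Matrix.mulVec_mulVec, Units.inv_mul, Matrix.one_mulVec]
  simp only [mem_L_iff hB hR, key]
  refine ⟨fun h v => ?_, fun h v => h _⟩
  have := h ((ξ : M2 p a b) *ᵥ v)
  rwa [hinv] at this

theorem IsSimilitude.norm_le_one (hB : IsRamifiedAt p a b) {h : (M2 p a b)ˣ} {ν : ℚ_[p]}
    (hh : IsSimilitude h ν) (hb : (h : M2 p a b) ∈ gradedBall p a b 1) : ‖ν‖ ≤ 1 := by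
  have := gradedBall_mul hB (gradedBall_formAdjoint hb) hb
  rw [hh.2] at this
  have := (mem_gradedBall.1 this).1.1
  simpa using this

/-- Stabilising the column lattice puts $h$ and $h^{-1}$ in the unit ball, so $\nu$ and $\nu^{-1}$
are both integral. Conversely, if $|\nu|=1$ then $h^{-1}=\nu^{-1}h^\dagger$ is in the unit ball as
soon as $h$ is. -/
theorem mem_Kminus_iff_mem_gradedBall (hB : IsRamifiedAt p a b)
    {R : Subalgebra ℤ_[p] (Bp p a b)} (hR : IsMaximalOrder R) {ξ : (M2 p a b)ˣ}
    {g : GU2 p a b} {ν : ℚ_[p]} (hν : IsSimilitude (ξ⁻¹ * (g : (M2 p a b)ˣ) * ξ) ν) :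
    g ∈ Kminus R ξ ↔ ‖ν‖ = 1 ∧
      ((ξ⁻¹ * (g : (M2 p a b)ˣ) * ξ : (M2 p a b)ˣ) : M2 p a b) ∈ gradedBall p a b 1 := by
  rw [mem_Kminus_iff hB hR]
  set h := ξ⁻¹ * (g : (M2 p a b)ˣ) * ξ
  have hinv (v : Fin 2 → Bp p a b) :
      ((h⁻¹ : (M2 p a b)ˣ) : M2 p a b) *ᵥ ((h : M2 p a b) *ᵥ v) = v := by
    rw [Matrix.mulVec_mulVec, Units.inv_mul, Matrix.one_mulVec]
  have hinv' (v : Fin 2 → Bp p a b) :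
      (h : M2 p a b) *ᵥ (((h⁻¹ : (M2 p a b)ˣ) : M2 p a b) *ᵥ v) = v := by
    rw [Matrix.mulVec_mulVec, Units.mul_inv, Matrix.one_mulVec]
  constructor
  · intro hv
    have h1 := mem_gradedBall_of_mulVec hB fun v => (hv v).2
    have h2 : ((h⁻¹ : (M2 p a b)ˣ) : M2 p a b) ∈ gradedBall p a b 1 :=
      mem_gradedBall_of_mulVec hB fun v hv' => (hv _).1 (by rwa [hinv'])
    refine ⟨le_antisymm (hν.norm_le_one hB h1) ?_, h1⟩
    have := hν.inv.norm_le_one hB h2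
    rw [norm_inv] at this
    exact (inv_le_one₀ (norm_pos_iff.2 hν.1)).1 this
  · rintro ⟨hn, h1⟩ v
    refine ⟨fun hv => ?_, mulVec_mem_columnLattice hB h1⟩
    have h2 := hν.inv_mem_gradedBall (by rwa [hn])
    rw [norm_inv, hn, inv_one] at h2
    have := mulVec_mem_columnLattice hB h2 hv
    rwa [hinv] at this

end ColumnLattice

/-! ### Fullness of the lattice and the two inclusions into its stabiliser -/

section Lattice

variable {p : ℕ} [Fact p.Prime] {a b : ℚ}

theorem latticeTilde_fg (hB : IsRamifiedAt p a b)
    {R : Subalgebra ℤ_[p] (Bp p a b)} (hR : IsMaximalOrder R) :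
    (latticeTilde R).FG := by
  have hfg : (Subalgebra.toSubmodule R).FG := hR.prop.fg
  let T : Submodule ℤ_[p] (Fin 2 → Fin 2 → Bp p a b) :=
    Submodule.pi Set.univ fun _ => Submodule.pi Set.univ fun _ => Subalgebra.toSubmodule R
  have hT : T.FG := Submodule.fg_pi fun _ => Submodule.fg_pi fun _ => hfg
  refine Submodule.FG.of_le (T := (T : Submodule ℤ_[p] (M2 p a b))) hT ?_
  have hstar {r : Bp p a b} (hr : r ∈ R) : star r ∈ R := by
    rw [hR.mem_iff hB] at hr ⊢
    rwa [nrd_star]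
  rintro _ ⟨r, hr, s, t, rfl⟩ i - j -
  fin_cases i <;> fin_cases j
  · exact hr
  · exact R.algebraMap_mem _
  · exact R.algebraMap_mem _
  · exact hstar hr

theorem span_latticeU (hB : IsRamifiedAt p a b) {R : Subalgebra ℤ_[p] (Bp p a b)}
    (hR : IsMaximalOrder R) {ξ : (M2 p a b)ˣ}
    (hξ : (ξ : M2 p a b)ᴴ * (ξ : M2 p a b) = H p a b) :
    Submodule.span ℚ_[p] (latticeU R ξ : Set (M2 p a b)) = Up p a b := by
  have hadj (A : M2 p a b) :
      formAdjoint (((ξ⁻¹ : (M2 p a b)ˣ) : M2 p a b) * A * (ξ : M2 p a b)) =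
        ((ξ⁻¹ : (M2 p a b)ˣ) : M2 p a b) * A * (ξ : M2 p a b) ↔ A ∈ Up p a b := by
    rw [formAdjoint_conj hξ, Units.mul_left_inj, Units.mul_right_inj]
    rfl
  refine le_antisymm (Submodule.span_le.2 fun A hA => ?_) fun A hA => ?_
  · exact (hadj A).1 ((mem_latticeTilde_iff hB hR).1 (mem_latticeU_iff.1 hA)).1
  · set X := ((ξ⁻¹ : (M2 p a b)ˣ) : M2 p a b) * A * (ξ : M2 p a b) with hX
    have hq := norm_prime_pos (p := p)
    -- The smallest weight $|p|^{j-i}$ is $|p|$, at the upper right entry; dividing by it for every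
    -- entry gives one exponent $n$ that works uniformly.
    obtain ⟨n, hn⟩ := exists_pow_mul_le (p := p)
      (∑ i, ∑ j, ‖nrd (X i j)‖ * ‖(p : ℚ_[p])‖⁻¹) one_pos
    set c : ℚ_[p] := (p : ℚ_[p]) ^ n with hc
    have hc0 : c ≠ 0 := pow_ne_zero _ prime_cast_ne_zero
    have hmem : c • A ∈ latticeU R ξ := by
      rw [mem_latticeU_iff, Matrix.mul_smul, Matrix.smul_mul, ← hX, mem_latticeTilde_iff hB hR]
      refine ⟨by rw [formAdjoint_smul, (hadj A).2 hA], fun i j => ?_⟩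
      have h1 : ‖c‖ ≤ 1 := by
        rw [hc, norm_pow]
        exact pow_le_one₀ hq.le Padic.norm_p_lt_one.le
      have h2 : ‖nrd (X i j)‖ * ‖(p : ℚ_[p])‖⁻¹ ≤
          ∑ i, ∑ j, ‖nrd (X i j)‖ * ‖(p : ℚ_[p])‖⁻¹ :=
        (Finset.single_le_sum (f := fun j => ‖nrd (X i j)‖ * ‖(p : ℚ_[p])‖⁻¹)
          (fun _ _ => by positivity) (Finset.mem_univ j)).trans
        (Finset.single_le_sum (f := fun i => ∑ j, ‖nrd (X i j)‖ * ‖(p : ℚ_[p])‖⁻¹)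
          (fun _ _ => by positivity) (Finset.mem_univ i))
      have h3 : ‖nrd ((c • X) i j)‖ * ‖(p : ℚ_[p])‖⁻¹ ≤ 1 := by
        refine le_trans ?_ hn
        rw [Matrix.smul_apply, nrd_smul, norm_mul, norm_pow, mul_assoc, ← norm_pow (p : ℚ_[p])]
        exact mul_le_mul (pow_le_of_le_one (norm_nonneg _) h1 two_ne_zero) h2 (by positivity)
          (norm_nonneg _)
      rw [mul_inv_le_iff₀ hq] at h3
      refine h3.trans (mul_le_mul_of_nonneg_left ?_ zero_le_one)
      calc ‖(p : ℚ_[p])‖ = ‖(p : ℚ_[p])‖ ^ (1 : ℤ) := (zpow_one _).symm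
        _ ≤ _ := zpow_le_zpow_right_of_le_one₀ hq Padic.norm_p_lt_one.le (by omega)
    rw [← inv_smul_smul₀ hc0 A]
    exact Submodule.smul_mem _ _ (Submodule.subset_span hmem)

theorem Kminus_le_stab (hB : IsRamifiedAt p a b) {R : Subalgebra ℤ_[p] (Bp p a b)}
    (hR : IsMaximalOrder R) {ξ : (M2 p a b)ˣ}
    (hξ : (ξ : M2 p a b)ᴴ * (ξ : M2 p a b) = H p a b) :
    Kminus R ξ ≤ stab (latticeU R ξ) := by
  intro g hg
  obtain ⟨ν, hν⟩ := exists_isSimilitude hξ g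
  rw [mem_Kminus_iff_mem_gradedBall hB hR hν] at hg
  rw [mem_stab_iff_mem_gradedBall hB hR hν, hg.1]
  exact hg.2

theorem isSimilitude_atkinLehner' : IsSimilitude (atkinLehner' p a b) (p : ℚ_[p]) := by
  refine ⟨prime_cast_ne_zero, ?_⟩
  have hs : (p : ℚ_[p]) • (1 : Bp p a b) = p := by
    rw [← Algebra.algebraMap_eq_smul_one, map_natCast]
  have e : ((atkinLehner' p a b : (M2 p a b)ˣ) : M2 p a b) = !![0, (p : Bp p a b); 1, 0] := rfl
  rw [e]
  ext1 i j
  rw [Matrix.mul_apply, Fin.sum_univ_two, formAdjoint_apply, formAdjoint_apply]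
  fin_cases i <;> fin_cases j <;> simp [hs, Fin.rev]

theorem conj_atkinLehner {ξ : (M2 p a b)ˣ}
    (hξ : (ξ : M2 p a b)ᴴ * (ξ : M2 p a b) = H p a b) :
    ξ⁻¹ * (atkinLehner ξ hξ : (M2 p a b)ˣ) * ξ = atkinLehner' p a b := by
  change ξ⁻¹ * (ξ * atkinLehner' p a b * ξ⁻¹) * ξ = _
  group

theorem atkinLehner_mem_stab (hB : IsRamifiedAt p a b) {R : Subalgebra ℤ_[p] (Bp p a b)}
    (hR : IsMaximalOrder R) {ξ : (M2 p a b)ˣ}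
    (hξ : (ξ : M2 p a b)ᴴ * (ξ : M2 p a b) = H p a b) :
    atkinLehner ξ hξ ∈ stab (latticeU R ξ) := by
  have h : IsSimilitude (ξ⁻¹ * (atkinLehner ξ hξ : (M2 p a b)ˣ) * ξ) (p : ℚ_[p]) := by
    rw [conj_atkinLehner]
    exact isSimilitude_atkinLehner'
  have e : ((atkinLehner' p a b : (M2 p a b)ˣ) : M2 p a b) = !![0, (p : Bp p a b); 1, 0] := rfl
  have hn : nrd (p : Bp p a b) = (p : ℚ_[p]) ^ 2 := by
    rw [← map_natCast (algebraMap ℚ_[p] (Bp p a b)), nrd_algebraMap]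
  rw [mem_stab_iff_mem_gradedBall hB hR h, conj_atkinLehner, mem_gradedBall, e]
  have hq := norm_prime_pos (p := p)
  -- With radius $|p|$, both nonzero entries attain their bounds: $|\mathrm{nrd}\,p|=|p|\cdot|p|$
  -- and $|\mathrm{nrd}\,1|=|p|\cdot|p|^{-1}$.
  refine ⟨⟨?_, ?_⟩, ?_, ?_⟩
  · simp
  · change ‖nrd (p : Bp p a b)‖ ≤ _
    rw [hn, norm_pow, sq]
  · change ‖nrd (1 : Bp p a b)‖ ≤ _
    rw [nrd_one, norm_one, mul_inv_cancel₀ hq.ne']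
  · simp

end Lattice

/-! ### Generation of the stabiliser by parity of the multiplier -/

section Generation

variable {p : ℕ} [Fact p.Prime] {a b : ℚ}

/-- The scalar matrix `c` as a unitary similitude. -/
noncomputable def scalarSimilitude (a b : ℚ) (c : ℚ_[p]) (hc : c ≠ 0) : GU2 p a b :=
  ⟨⟨c • 1, c⁻¹ • 1, by simp [smul_smul, hc], by simp [smul_smul, hc]⟩, c * c, mul_ne_zero hc hc, by
    have h : (c • (1 : M2 p a b))ᴴ = c • 1 := (Up p a b).smul_mem c (Matrix.conjTranspose_one)
    change (c • (1 : M2 p a b))ᴴ * (c • 1) = _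
    rw [h, Matrix.smul_mul, Matrix.one_mul, smul_smul]⟩

theorem scalarSimilitude_mem (c : ℚ_[p]) (hc : c ≠ 0) :
    scalarSimilitude a b c hc ∈ scalars p a b := ⟨c, hc, rfl⟩

/-- An element of the stabilizer whose multiplier has even valuation is a scalar multiple of an
element of `K_p^-`. -/
theorem exists_mem_Kminus_of_even (hB : IsRamifiedAt p a b) {R : Subalgebra ℤ_[p] (Bp p a b)}
    (hR : IsMaximalOrder R) {ξ : (M2 p a b)ˣ} {g : GU2 p a b} {ν : ℚ_[p]}
    (hν : IsSimilitude (ξ⁻¹ * (g : (M2 p a b)ˣ) * ξ) ν)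
    (hg : g ∈ stab (latticeU R ξ)) {c : ℚ_[p]} (hc : c ≠ 0) (hcν : ‖ν‖ = ‖c‖ ^ 2) :
    ∃ k ∈ Kminus R ξ,
      QuotientGroup.mk' (scalars p a b) k = QuotientGroup.mk' (scalars p a b) g := by
  have hc' := inv_ne_zero hc
  have hval : ((ξ⁻¹ * ((scalarSimilitude a b c⁻¹ hc' * g : GU2 p a b) : (M2 p a b)ˣ) * ξ :
      (M2 p a b)ˣ) : M2 p a b) =
      c⁻¹ • ((ξ⁻¹ * (g : (M2 p a b)ˣ) * ξ : (M2 p a b)ˣ) : M2 p a b) := by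
    change ((ξ⁻¹ : (M2 p a b)ˣ) : M2 p a b) * ((c⁻¹ • (1 : M2 p a b)) *
      ((g : (M2 p a b)ˣ) : M2 p a b)) * (ξ : M2 p a b) = c⁻¹ • (((ξ⁻¹ : (M2 p a b)ˣ) : M2 p a b) *
      ((g : (M2 p a b)ˣ) : M2 p a b) * (ξ : M2 p a b))
    rw [Matrix.smul_mul, Matrix.one_mul, Matrix.mul_smul, Matrix.smul_mul]
  have hsim : IsSimilitude (ξ⁻¹ * ((scalarSimilitude a b c⁻¹ hc' * g : GU2 p a b) :
      (M2 p a b)ˣ) * ξ) (c⁻¹ * c⁻¹ * ν) := by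
    refine ⟨mul_ne_zero (mul_ne_zero hc' hc') hν.1, ?_⟩
    rw [hval, formAdjoint_smul, Matrix.smul_mul, Matrix.mul_smul, hν.2, smul_smul, smul_smul,
      mul_assoc]
  have hcn : ‖c‖ ≠ 0 := norm_ne_zero_iff.2 hc
  -- Dividing by $c$ makes the multiplier $c^{-2}\nu$ a unit and, at the same time, shrinks the
  -- radius $|\nu|$ to $|c|^{-2}|\nu|=1$.
  refine ⟨scalarSimilitude a b c⁻¹ hc' * g, ?_, ?_⟩
  · rw [mem_Kminus_iff_mem_gradedBall hB hR hsim, hval]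
    rw [mem_stab_iff_mem_gradedBall hB hR hν] at hg
    refine ⟨?_, ?_⟩
    · rw [norm_mul, norm_mul, norm_inv, hcν]
      field_simp
    · convert gradedBall_smul c⁻¹ hg using 1
      rw [norm_inv, hcν]
      field_simp
  · rw [map_mul, show QuotientGroup.mk' (scalars p a b) (scalarSimilitude a b c⁻¹ hc') = 1 from
      (QuotientGroup.eq_one_iff _).2 (scalarSimilitude_mem _ _), one_mul]

theorem exists_norm_eq_zpow {ν : ℚ_[p]} (hν : ν ≠ 0) :
    ∃ k : ℤ, ‖ν‖ = ‖(p : ℚ_[p]) ^ k‖ :=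
  ⟨ν.valuation, by
    rw [Padic.norm_eq_zpow_neg_valuation hν, norm_zpow, Padic.norm_p, inv_zpow, zpow_neg]⟩

theorem closure_eq_map_stab (hB : IsRamifiedAt p a b) {R : Subalgebra ℤ_[p] (Bp p a b)}
    (hR : IsMaximalOrder R) {ξ : (M2 p a b)ˣ}
    (hξ : (ξ : M2 p a b)ᴴ * (ξ : M2 p a b) = H p a b) :
    Subgroup.closure
        (QuotientGroup.mk' (scalars p a b) '' (Kminus R ξ : Set (GU2 p a b)) ∪
          {QuotientGroup.mk' (scalars p a b) (atkinLehner ξ hξ)}) =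
      (stab (latticeU R ξ)).map (QuotientGroup.mk' (scalars p a b)) := by
  have hp0 := prime_cast_ne_zero (p := p)
  have hω := atkinLehner_mem_stab hB hR hξ
  apply le_antisymm
  · rw [Subgroup.closure_le]
    rintro _ (⟨k, hk, rfl⟩ | rfl)
    · exact ⟨k, Kminus_le_stab hB hR hξ hk, rfl⟩
    · exact ⟨_, hω, rfl⟩
  · rintro _ ⟨g, hg, rfl⟩
    obtain ⟨ν, hν⟩ := exists_isSimilitude hξ g
    obtain ⟨k, hk⟩ := exists_norm_eq_zpow hν.1
    rcases Int.even_or_odd' k with ⟨m, rfl | rfl⟩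
    · obtain ⟨l, hl, he⟩ := exists_mem_Kminus_of_even hB hR hν hg
        (zpow_ne_zero m hp0) (by rw [hk, mul_comm, zpow_mul, norm_zpow]; norm_cast)
      rw [← he]
      exact Subgroup.subset_closure (Or.inl ⟨l, hl, rfl⟩)
    -- For odd valuation $2m+1$, left multiplication by $\omega_p^{-1}$ divides the multiplier by
    -- $p$ and stays in the stabiliser, leaving the even valuation $2m$.
    · have hν' : IsSimilitude
          (ξ⁻¹ * (((atkinLehner ξ hξ)⁻¹ * g : GU2 p a b) : (M2 p a b)ˣ) * ξ) ((p : ℚ_[p])⁻¹ * ν) := by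
        convert (isSimilitude_atkinLehner' (p := p) (a := a) (b := b)).inv.mul hν using 1
        rw [← conj_atkinLehner hξ, Subgroup.coe_mul, Subgroup.coe_inv]
        group
      obtain ⟨l, hl, he⟩ := exists_mem_Kminus_of_even hB hR hν'
        ((stab (latticeU R ξ)).mul_mem ((stab (latticeU R ξ)).inv_mem hω) hg)
        (zpow_ne_zero m hp0) (by
          rw [norm_mul, hk, ← norm_mul, zpow_add₀ hp0, zpow_one, mul_comm, mul_assoc,
            mul_inv_cancel₀ hp0, mul_one, mul_comm, zpow_mul, norm_zpow]
          norm_cast)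
      have hg' : QuotientGroup.mk' (scalars p a b) g =
          QuotientGroup.mk' (scalars p a b) (atkinLehner ξ hξ) *
            QuotientGroup.mk' (scalars p a b) l := by
        rw [he, ← map_mul, mul_inv_cancel_left]
      rw [hg']
      exact Subgroup.mul_mem _ (Subgroup.subset_closure (Or.inr rfl))
        (Subgroup.subset_closure (Or.inl ⟨l, hl, rfl⟩))

end Generation

end QuatUnitary

theorem mainTheorem11 (p : ℕ) [Fact p.Prime] (a b : ℚ) (hB : IsRamifiedAt p a b)
    (R : Subalgebra ℤ_[p] (Bp p a b)) (hR : IsMaximalOrder R)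
    (ξ : (M2 p a b)ˣ) (hξ : (ξ : M2 p a b)ᴴ * (ξ : M2 p a b) = H p a b) :
    -- the lattice is a full lattice in the space of hermitian matrices
    (latticeU R ξ).FG ∧
    Submodule.span ℚ_[p] (latticeU R ξ : Set (M2 p a b)) = Up p a b ∧
    -- it is preserved by the stabiliser of `L_p` and by the Atkin–Lehner element
    Kminus R ξ ≤ stab (latticeU R ξ) ∧
    atkinLehner ξ hξ ∈ stab (latticeU R ξ) ∧
    -- modulo scalars these generate its full stabiliser
    Subgroup.closure
        (QuotientGroup.mk' (scalars p a b) '' (Kminus R ξ : Set (GU2 p a b)) ∪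
          {QuotientGroup.mk' (scalars p a b) (atkinLehner ξ hξ)}) =
      (stab (latticeU R ξ)).map (QuotientGroup.mk' (scalars p a b)) := by
  exact ⟨(latticeTilde_fg hB hR).map _, span_latticeU hB hR hξ, Kminus_le_stab hB hR hξ,
    atkinLehner_mem_stab hB hR hξ, closure_eq_map_stab hB hR hξ⟩
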